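/- Let $n\ge 3$, let $(\mathbb S^n,g)$ be the unit round sphere, and put $N=\frac{2n}{n-2}$. Fix a point $p\in\mathbb S^n$; a function on $\mathbb S^n$ is called radial if it depends only on the geodesic distance $r$ to $p$. For a $1$-form $W$ let $(LW)_{ij}=\nabla_iW_j+\nabla_jW_i-\frac2n(\operatorname{div}W)\,g_{ij}$. For $\tau\in C^1(\mathbb S^n)$ consider the vacuum conformal constraint equations with vanishing TT-tensor $$ -\tfrac{4(n-1)}{n-2}\Delta\varphi+\mathrm{Scal}_g\,\varphi=-\tfrac{n-1}{n}\tau^2\varphi^{N-1}+\frac{|LW|^2}{\varphi^{N+1}},\qquad \operatorname{div}(LW)=\tfrac{n-1}{n}\varphi^N\,d\tau . $$ Let $k\in\{2,3,\dots,\infty\}$. A solution is a positive function $\varphi\in C^k(\mathbb S^n)$ for which there is a $1$-form $W$ of class $C^2$ such that $(\varphi,W)$ satisfies both equations. Let $\tau\in C^1(\mathbb S^n)$ be radial. Then: 1. there is no radial solution $\varphi$; 2. if $\varphi$ is a solution and $A\in O(n+1)$ satisfies $Ap=p$, then $\varphi\circ A$ is also a solution; 3. consequently, if a solution exists, then the set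 of all solutions $\varphi$ is infinite. -/

import Mathlib

open scoped Manifold ContDiff RealInnerProductSpace

namespace RoundSphere

noncomputable section

/-- The Euclidean space `ℝⁿ⁺¹` containing the unit sphere. -/
abbrev Ambient (n : ℕ) : Type := EuclideanSpace ℝ (Fin (n + 1))

/-- The unit sphere `𝕊ⁿ ⊆ ℝⁿ⁺¹`. It carries the round metric, the restriction of the Euclidean
inner product to the tangent spaces `T_x 𝕊ⁿ = x^⊥`. -/
abbrev Sph (n : ℕ) : Type := Metric.sphere (0 : Ambient n) 1

variable {n : ℕ} {F : Type*} [NormedAddCommGroup F] [NormedSpace ℝ F]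

/-- The geodesic distance of the round sphere. -/
def geodesicDist (p x : Sph n) : ℝ :=
  InnerProductGeometry.angle (p : Ambient n) (x : Ambient n)

/-- A function is radial with respect to the point `p` if it is a function of the geodesic
distance to `p`. -/
def IsRadial (p : Sph n) (f : Sph n → ℝ) : Prop :=
  ∃ h : ℝ → ℝ, ∀ x, f x = h (geodesicDist p x)

/-- The rotation of the sphere given by a linear isometry of `ℝⁿ⁺¹`. -/
def rotate (A : Ambient n ≃ₗᵢ[ℝ] Ambient n) (x : Sph n) : Sph n :=
  ⟨A x, by simp⟩

/-- The extension of a function on the sphere to `ℝⁿ⁺¹ \ {0}` that is constant along rays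
(with the value `0` at the origin, which plays no role). -/
def rayExtension (f : Sph n → F) (y : Ambient n) : F :=
  if hy : y = 0 then 0
  else f ⟨‖y‖⁻¹ • y, by simp [norm_smul, inv_mul_cancel₀ (norm_ne_zero_iff.mpr hy)]⟩

/-- The differential `df_x` of a function on the sphere, extended by zero to the normal line
`ℝ x`: it is the derivative at `x` of the extension of `f` that is constant along rays. -/
def differential (f : Sph n → F) (x : Sph n) : Ambient n →L[ℝ] F :=
  fderiv ℝ (rayExtension f) (x : Ambient n)

/-- The orthogonal projection of `ℝⁿ⁺¹` onto the tangent space `T_x 𝕊ⁿ = x^⊥`. -/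
def tangentProj (x : Sph n) (v : Ambient n) : Ambient n :=
  v - ⟪(x : Ambient n), v⟫ • (x : Ambient n)

/-- The round metric at `x`, extended by zero to the normal line. -/
def metric (x : Sph n) (a b : Ambient n) : ℝ :=
  ⟪tangentProj x a, tangentProj x b⟫

/-- The Levi-Civita connection of the sphere on tangent vector fields (regarded as maps into
`ℝⁿ⁺¹`): the tangential part of the derivative of `Y` in the direction of `X`. -/
def connection (X Y : Sph n → Ambient n) (x : Sph n) : Ambient n :=
  tangentProj x (differential Y x (X x))

/-- The Lie bracket of tangent vector fields, `[X, Y] = ∇_X Y - ∇_Y X`. -/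
def bracket (X Y : Sph n → Ambient n) (x : Sph n) : Ambient n :=
  connection X Y x - connection Y X x

/-- The tangent vector field `y ↦ P_y a`, where `P_y` is the orthogonal projection onto `T_y 𝕊ⁿ`.
It extends the tangential part of `a` at each point. -/
def tangentField (a : Ambient n) (y : Sph n) : Ambient n :=
  tangentProj y a

/-- The Riemann curvature `R(X, Y) Z = ∇_X ∇_Y Z - ∇_Y ∇_X Z - ∇_[X, Y] Z`, at the tangential
parts of `a, b, c`. -/
def curvature (x : Sph n) (a b c : Ambient n) : Ambient n :=
  connection (tangentField a) (connection (tangentField b) (tangentField c)) x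
    - connection (tangentField b) (connection (tangentField a) (tangentField c)) x
    - connection (bracket (tangentField a) (tangentField b)) (tangentField c) x

/-- The standard orthonormal basis of `ℝⁿ⁺¹`. All tensors below are extended by zero to the normal
line, hence traces and norms over `T_x 𝕊ⁿ` (sums over an orthonormal basis of `x^⊥`) agree with the
corresponding sums over any orthonormal basis of `ℝⁿ⁺¹`. -/
def frame (i : Fin (n + 1)) : Ambient n :=
  EuclideanSpace.basisFun (Fin (n + 1)) ℝ i

/-- The scalar curvature. -/
def scalarCurvature (x : Sph n) : ℝ :=
  ∑ i, ∑ j, metric x (curvature x (frame i) (frame j) (frame j)) (frame i)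

/-- A `1`-form on the sphere, each covector being extended by zero to the normal line. -/
def IsOneForm (W : Sph n → Ambient n →L[ℝ] ℝ) : Prop :=
  ∀ x : Sph n, W x (x : Ambient n) = 0

/-- The covariant derivative of a `1`-form, `(∇_A W)(B) = A (W(B)) - W(∇_A B)`. -/
def covOneForm (W : Sph n → Ambient n →L[ℝ] ℝ) (x : Sph n) (a b : Ambient n) : ℝ :=
  differential (fun y => W y (tangentField b y)) x (tangentField a x)
    - W x (connection (tangentField a) (tangentField b) x)

/-- The covariant derivative of a `(0,2)`-tensor,
`(∇_A T)(B, C) = A (T(B, C)) - T(∇_A B, C) - T(B, ∇_A C)`. -/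
def covTwoTensor (T : Sph n → Ambient n → Ambient n → ℝ) (x : Sph n) (a b c : Ambient n) : ℝ :=
  differential (fun y => T y (tangentField b y) (tangentField c y)) x (tangentField a x)
    - T x (connection (tangentField a) (tangentField b) x) (tangentField c x)
    - T x (tangentField b x) (connection (tangentField a) (tangentField c) x)

/-- The divergence of a `1`-form, `∇ⁱ W_i`. -/
def divOneForm (W : Sph n → Ambient n →L[ℝ] ℝ) (x : Sph n) : ℝ :=
  ∑ i, covOneForm W x (frame i) (frame i)

/-- The divergence of a symmetric `(0,2)`-tensor, `(div T)_j = ∇ⁱ T_{ij}`. -/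
def divTwoTensor (T : Sph n → Ambient n → Ambient n → ℝ) (x : Sph n) (b : Ambient n) : ℝ :=
  ∑ i, covTwoTensor T x (frame i) (frame i) b

/-- The squared norm `|T|²` of a `(0,2)`-tensor. -/
def normSqTwoTensor (T : Sph n → Ambient n → Ambient n → ℝ) (x : Sph n) : ℝ :=
  ∑ i, ∑ j, T x (frame i) (frame j) ^ 2

/-- The Laplace operator `Δ f = div (df) = ∇ⁱ ∇_i f`. -/
def laplacian (f : Sph n → ℝ) (x : Sph n) : ℝ :=
  divOneForm (differential f) x

/-- The conformal Killing operator
`(LW)_{ij} = ∇_i W_j + ∇_j W_i - (2 / n) (div W) g_{ij}`. -/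
def conformalKilling (W : Sph n → Ambient n →L[ℝ] ℝ) (x : Sph n) (a b : Ambient n) : ℝ :=
  covOneForm W x a b + covOneForm W x b a - 2 / (n : ℝ) * divOneForm W x * metric x a b

/-- The critical exponent `N = 2n / (n - 2)`. -/
def critExp (n : ℕ) : ℝ := 2 * (n : ℝ) / ((n : ℝ) - 2)

/-- `(φ, W)` is a solution of the vacuum conformal constraint equations on the round sphere with
mean curvature `τ` and vanishing TT-tensor, where `φ` is a positive function of class `C^k` and
`W` is a `1`-form of class `C²`. -/
structure IsConformalSolution (k : ℕ∞) (τ φ : Sph n → ℝ) (W : Sph n → Ambient n →L[ℝ] ℝ) :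
    Prop where
  pos : ∀ x, 0 < φ x
  contMDiff_factor : ContMDiff (𝓡 n) 𝓘(ℝ, ℝ) k φ
  isOneForm : IsOneForm W
  contMDiff_form : ContMDiff (𝓡 n) 𝓘(ℝ, Ambient n →L[ℝ] ℝ) 2 W
  lichnerowicz : ∀ x,
    -(4 * ((n : ℝ) - 1) / ((n : ℝ) - 2)) * laplacian φ x + scalarCurvature x * φ x
      = -(((n : ℝ) - 1) / n) * τ x ^ 2 * φ x ^ (critExp n - 1)
        + normSqTwoTensor (conformalKilling W) x / φ x ^ (critExp n + 1)
  vector : ∀ x : Sph n, ∀ b : Ambient n, ⟪(x : Ambient n), b⟫ = 0 →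
    divTwoTensor (conformalKilling W) x b
      = ((n : ℝ) - 1) / n * φ x ^ critExp n * differential τ x b

/-- The set of solutions `φ` (of class `C^k`) of the vacuum conformal constraint equations with
mean curvature `τ` and vanishing TT-tensor. -/
def solutionSet (k : ℕ∞) (τ : Sph n → ℝ) : Set (Sph n → ℝ) :=
  {φ | ∃ W, IsConformalSolution k τ φ W}

end

end RoundSphere

/-!
A radial solution `φ` would describe rotationally symmetric vacuum initial data on a closed sphere,
and by Birkhoff's theorem such data embed in the Schwarzschild spacetime. Regularity at the pole
forces the mass to vanish, but Minkowski spacetime has no closed Cauchy surface. The proof makes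
this explicit for the constraint equations themselves.

The `1`-form `W` need not be radial, but `LW` is invariant under every isometry `A` fixing the pole
`p` when `φ` and `τ` are radial: `V = W - A^* W` satisfies `div LV = 0`, and integrating the
divergence of the vector field `LV(·, V)`, which is `|LV|² / 2`, gives `LV = 0`
(`killingForm_eq_zero`). The divergence theorem used here is reduced to Lebesgue measure on `ℝⁿ⁺¹`
by extending tangential fields along rays and cutting off in the radial direction
(`div_eq_zero_of_nonneg`). Invariance under the reflections fixing `p` then shows that along a
meridian `LW` is diagonal and determined by its radial component `f`, so that the constraint
equations become ordinary differential equations for `φ`, `f` and `τ`. They make the Misner–Sharp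
mass constant, hence zero, and this contradicts the existence of a sphere of latitude of critical
area (`no_radial_ode`).

The equations are natural under isometries, so the isometries fixing `p` act on the solutions. A
solution `φ` is not radial, so it takes two different values, and by connectedness infinitely many
values, on some sphere of latitude; as the isometries fixing `p` act transitively on that sphere,
the functions `φ ∘ A` take infinitely many values at one fixed point.

All tensors are extended by zero to the normal line. The covariant derivatives of the sphere are
thereby expressed by flat derivatives of extensions along rays, with the second fundamental form as
correction (`covOneForm_eq`, `covTwoTensor_eq`).
-/

namespace RoundSphere

variable {n : ℕ} {F : Type*} [NormedAddCommGroup F] [NormedSpace ℝ F]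

/-! ### Functions on the sphere and their extensions along rays -/

@[simp] lemma norm_coe (x : Sph n) : ‖(x : Ambient n)‖ = 1 := by
  simp

@[simp] lemma inner_coe_self (x : Sph n) : ⟪(x : Ambient n), (x : Ambient n)⟫ = 1 := by
  rw [real_inner_self_eq_norm_sq, norm_coe, one_pow]

lemma coe_ne_zero (x : Sph n) : (x : Ambient n) ≠ 0 := by
  rw [← norm_ne_zero_iff, norm_coe]; exact one_ne_zero

lemma coe_mem_compl (x : Sph n) : (x : Ambient n) ∈ ({0}ᶜ : Set (Ambient n)) :=
  coe_ne_zero x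

/-- The radial projection of a nonzero vector to the unit sphere. -/
noncomputable def unit (y : Ambient n) (hy : y ≠ 0) : Sph n :=
  ⟨‖y‖⁻¹ • y, by simp [norm_smul, inv_mul_cancel₀ (norm_ne_zero_iff.mpr hy)]⟩

lemma rayExtension_of_ne {G : Type*} [NormedAddCommGroup G] (f : Sph n → G) {y : Ambient n}
    (hy : y ≠ 0) : rayExtension f y = f (unit y hy) := by
  simp [rayExtension, hy, unit]

lemma unit_coe (x : Sph n) : unit (x : Ambient n) (coe_ne_zero x) = x := by
  ext1; simp [unit]

@[simp] lemma rayExtension_coe {G : Type*} [NormedAddCommGroup G] (f : Sph n → G) (x : Sph n) :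
    rayExtension f (x : Ambient n) = f x := by
  rw [rayExtension_of_ne f (coe_ne_zero x), unit_coe]

lemma unit_smul {c : ℝ} (hc : 0 < c) {y : Ambient n} (hy : y ≠ 0) :
    unit (c • y) (smul_ne_zero hc.ne' hy) = unit y hy := by
  ext1
  simp only [unit, norm_smul, Real.norm_of_nonneg hc.le, smul_smul]
  congr 1
  have := norm_ne_zero_iff.mpr hy
  field_simp

lemma rayExtension_smul {G : Type*} [NormedAddCommGroup G] (f : Sph n → G) {c : ℝ}
    (hc : 0 < c) (y : Ambient n) : rayExtension f (c • y) = rayExtension f y := by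
  by_cases hy : y = 0
  · simp [hy]
  · rw [rayExtension_of_ne f (smul_ne_zero hc.ne' hy), unit_smul hc hy, rayExtension_of_ne f hy]

/-- A function on the sphere is of class `C^k` if its extension along rays is so away from the
origin. -/
def SphDiff (k : WithTop ℕ∞) (f : Sph n → F) : Prop :=
  ContDiffOn ℝ k (rayExtension f) {0}ᶜ

lemma isOpen_punctured : IsOpen ({0}ᶜ : Set (Ambient n)) := isOpen_compl_singleton

lemma SphDiff.contDiffAt {k : WithTop ℕ∞} {f : Sph n → F} (hf : SphDiff k f) {y : Ambient n}
    (hy : y ≠ 0) : ContDiffAt ℝ k (rayExtension f) y :=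
  ContDiffOn.contDiffAt hf (isOpen_punctured.mem_nhds hy)

lemma SphDiff.differentiableAt {k : WithTop ℕ∞} {f : Sph n → F} (hf : SphDiff k f) (hk : k ≠ 0)
    {y : Ambient n} (hy : y ≠ 0) : DifferentiableAt ℝ (rayExtension f) y :=
  (hf.contDiffAt hy).differentiableAt hk

lemma contDiffOn_normalize (k : WithTop ℕ∞) :
    ContDiffOn ℝ k (fun y : Ambient n => ‖y‖⁻¹ • y) {0}ᶜ := by
  intro y hy
  have h : ContDiffAt ℝ k (fun y : Ambient n => ‖y‖) y := contDiffAt_norm ℝ hy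
  exact ((h.inv (norm_ne_zero_iff.mpr hy)).smul contDiffAt_id).contDiffWithinAt

lemma SphDiff.of_contMDiff {k : WithTop ℕ∞} {f : Sph n → F}
    (hf : ContMDiff (𝓡 n) 𝓘(ℝ, F) k f) : SphDiff k f := by
  have : Fact (Module.finrank ℝ (Ambient n) = n + 1) := ⟨by simp⟩
  let U : TopologicalSpace.Opens (Ambient n) := ⟨{0}ᶜ, isOpen_punctured⟩
  have h1 : ContMDiff 𝓘(ℝ, Ambient n) 𝓘(ℝ, Ambient n) k
      (fun y : U => ‖(y : Ambient n)‖⁻¹ • (y : Ambient n)) := by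
    intro y
    have := ((contDiffOn_normalize (n := n) k).contDiffAt
      (isOpen_punctured.mem_nhds y.2)).contMDiffAt
    exact contMDiffAt_subtype_iff (f := fun y : Ambient n => ‖y‖⁻¹ • y) |>.2 this
  have h2 := h1.codRestrict_sphere (n := n) (fun y => (unit (y : Ambient n) y.2).2)
  have h3 := hf.comp h2
  intro y hy
  have h4 := h3 ⟨y, hy⟩
  have h5 : f ∘ (Set.codRestrict _ _ (fun y : U => (unit (y : Ambient n) y.2).2) : U → Sph n)
      = fun y : U => rayExtension f (y : Ambient n) := by
    funext z
    rw [rayExtension_of_ne f z.2]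
    rfl
  have h6 : ContMDiffAt 𝓘(ℝ, Ambient n) 𝓘(ℝ, F) k (fun y : U => rayExtension f (y : Ambient n))
      ⟨y, hy⟩ := by
    rw [← h5]; exact h4
  exact (contMDiffAt_subtype_iff.1 h6).contDiffAt.contDiffWithinAt

/-- The restriction to the sphere of a function of class `C^k` on `ℝⁿ⁺¹ \ {0}` is of class
`C^k`. -/
lemma SphDiff.restrict {k : WithTop ℕ∞} {g : Ambient n → F} (hg : ContDiffOn ℝ k g {0}ᶜ) :
    SphDiff k (fun x : Sph n => g x) := by
  have : ContDiffOn ℝ k (g ∘ fun y : Ambient n => ‖y‖⁻¹ • y) {0}ᶜ := by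
    refine hg.comp (contDiffOn_normalize k) ?_
    intro y hy
    exact coe_ne_zero (unit y hy)
  refine this.congr ?_
  intro y hy
  rw [rayExtension_of_ne _ hy]
  rfl

lemma SphDiff.differential {k : WithTop ℕ∞} {f : Sph n → F} (hf : SphDiff (k + 1) f) :
    SphDiff k (differential f) :=
  SphDiff.restrict (hf.fderiv_of_isOpen isOpen_punctured le_rfl)

lemma SphDiff.of_le {k l : WithTop ℕ∞} {f : Sph n → F} (hf : SphDiff l f) (h : k ≤ l) :
    SphDiff k f := ContDiffOn.of_le hf h

lemma SphDiff.clm {G : Type*} [NormedAddCommGroup G] [NormedSpace ℝ G] {k : WithTop ℕ∞}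
    {f : Sph n → F} (L : F →L[ℝ] G) (hf : SphDiff k f) : SphDiff k (fun x => L (f x)) := by
  refine (L.contDiff.comp_contDiffOn hf).congr fun y hy => ?_
  simp [rayExtension_of_ne _ hy]

lemma SphDiff.add {k : WithTop ℕ∞} {f g : Sph n → F} (hf : SphDiff k f) (hg : SphDiff k g) :
    SphDiff k (fun x => f x + g x) := by
  refine (ContDiffOn.add hf hg).congr fun y hy => ?_
  simp [rayExtension_of_ne _ hy]

lemma SphDiff.sub {k : WithTop ℕ∞} {f g : Sph n → F} (hf : SphDiff k f) (hg : SphDiff k g) :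
    SphDiff k (fun x => f x - g x) := by
  refine (ContDiffOn.sub hf hg).congr fun y hy => ?_
  simp [rayExtension_of_ne _ hy]

lemma SphDiff.smul {k : WithTop ℕ∞} {f : Sph n → ℝ} {g : Sph n → F} (hf : SphDiff k f)
    (hg : SphDiff k g) : SphDiff k (fun x => f x • g x) := by
  refine (ContDiffOn.smul hf hg).congr fun y hy => ?_
  simp [rayExtension_of_ne _ hy]

lemma differential_clm {G : Type*} [NormedAddCommGroup G] [NormedSpace ℝ G] {k : WithTop ℕ∞}
    (hk : k ≠ 0) {f : Sph n → F} (L : F →L[ℝ] G) (hf : SphDiff k f) (x : Sph n) (v : Ambient n) :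
    differential (fun x => L (f x)) x v = L (differential f x v) := by
  have h : rayExtension (fun x => L (f x)) = L ∘ rayExtension f := by
    funext y
    by_cases hy : y = 0
    · simp [rayExtension, hy]
    · simp [rayExtension_of_ne _ hy]
  rw [differential, h, (L.hasFDerivAt.comp (x : Ambient n)
    (hf.differentiableAt hk (coe_ne_zero x)).hasFDerivAt).fderiv]
  rfl

/-- The differential of the restriction to the sphere of a function on `ℝⁿ⁺¹`. -/
lemma differential_restrict {g : Ambient n → F} {x : Sph n}
    (hg : DifferentiableAt ℝ g x) (v : Ambient n) :
    differential (fun x : Sph n => g x) x v = fderiv ℝ g x (tangentProj x v) := by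
  have hN : HasFDerivAt (fun y : Ambient n => ‖y‖⁻¹ • y)
      (ContinuousLinearMap.id ℝ (Ambient n) - (innerSL ℝ (x : Ambient n)).smulRight
        (x : Ambient n)) (x : Ambient n) := by
    have h0 : HasFDerivAt (fun y : Ambient n => ‖y‖ ^ 2) (2 • innerSL ℝ (x : Ambient n))
        (x : Ambient n) := (hasStrictFDerivAt_norm_sq (x : Ambient n)).hasFDerivAt
    have h1 : HasFDerivAt (fun y : Ambient n => (Real.sqrt (‖y‖ ^ 2))⁻¹)
        (-(innerSL ℝ (x : Ambient n))) (x : Ambient n) := by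
      have ha : HasDerivAt (fun t : ℝ => (Real.sqrt t)⁻¹) (-(1 / 2)) (‖(x : Ambient n)‖ ^ 2) := by
        have := (Real.hasDerivAt_sqrt (x := 1) one_ne_zero).inv (by simp)
        rw [norm_coe, one_pow]
        exact this.congr_deriv (by simp)
      refine (ha.comp_hasFDerivAt (x : Ambient n) h0).congr_fderiv ?_
      ext v; simp
    have h2 : HasFDerivAt (fun y : Ambient n => ‖y‖⁻¹) (-(innerSL ℝ (x : Ambient n)))
        (x : Ambient n) := by
      simpa [Real.sqrt_sq] using h1
    refine (h2.smul (hasFDerivAt_id (x : Ambient n))).congr_fderiv ?_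
    ext1 v
    simp [sub_eq_add_neg]
  have hx : ‖(x : Ambient n)‖⁻¹ • (x : Ambient n) = x := by simp
  have hg' : HasFDerivAt g (fderiv ℝ g x) (‖(x : Ambient n)‖⁻¹ • (x : Ambient n)) := by
    rw [hx]; exact hg.hasFDerivAt
  have h := HasFDerivAt.comp (f := fun y : Ambient n => ‖y‖⁻¹ • y) (x : Ambient n) hg' hN
  have he : rayExtension (fun x : Sph n => g x)
      =ᶠ[nhds (x : Ambient n)] (g ∘ fun y : Ambient n => ‖y‖⁻¹ • y) := by
    filter_upwards [isOpen_punctured.mem_nhds (coe_mem_compl x)] with y hy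
    rw [rayExtension_of_ne _ hy]; rfl
  rw [differential, (h.congr_of_eventuallyEq he).fderiv]
  simp [tangentProj]

/-- The differential vanishes on the normal line. -/
lemma differential_tangentProj {k : WithTop ℕ∞} (hk : k ≠ 0) {f : Sph n → F} (hf : SphDiff k f)
    (x : Sph n) (v : Ambient n) : differential f x (tangentProj x v) = differential f x v := by
  have h := differential_restrict (hf.differentiableAt hk (coe_ne_zero x)) v
  simp only [rayExtension_coe] at h
  exact h.symm

lemma differential_self {k : WithTop ℕ∞} (hk : k ≠ 0) {f : Sph n → F} (hf : SphDiff k f)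
    (x : Sph n) : differential f x (x : Ambient n) = 0 := by
  rw [← differential_tangentProj hk hf]
  simp [tangentProj]

/-- The chain rule along a curve on the sphere. -/
lemma hasDerivAt_comp_curve {k : WithTop ℕ∞} (hk : k ≠ 0) {f : Sph n → F} (hf : SphDiff k f)
    {c : ℝ → Sph n} {c' : Ambient n} {t : ℝ}
    (hc : HasDerivAt (fun t => (c t : Ambient n)) c' t) :
    HasDerivAt (fun t => f (c t)) (differential f (c t) c') t := by
  have h := ((hf.differentiableAt hk (coe_ne_zero (c t))).hasFDerivAt).comp_hasDerivAt t hc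
  exact h.congr_of_eventuallyEq (Filter.Eventually.of_forall fun s => by simp)

/-- The differential of the extension along rays is homogeneous of degree `-1`. -/
lemma fderiv_rayExtension {k : WithTop ℕ∞} (hk : k ≠ 0) {f : Sph n → F} (hf : SphDiff k f)
    {y : Ambient n} (hy : y ≠ 0) :
    fderiv ℝ (rayExtension f) y = ‖y‖⁻¹ • differential f (unit y hy) := by
  have hpos : 0 < ‖y‖⁻¹ := inv_pos.2 (norm_pos_iff.2 hy)
  have h1 : rayExtension f = rayExtension f ∘ fun z : Ambient n => ‖y‖⁻¹ • z := by
    funext z; simp [rayExtension_smul f hpos]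
  have h2 : HasFDerivAt (fun z : Ambient n => ‖y‖⁻¹ • z)
      (‖y‖⁻¹ • ContinuousLinearMap.id ℝ (Ambient n)) y := (hasFDerivAt_id y).const_smul (‖y‖⁻¹)
  have h3 : HasFDerivAt (rayExtension f) (differential f (unit y hy)) (‖y‖⁻¹ • y) :=
    (hf.differentiableAt hk (coe_ne_zero (unit y hy))).hasFDerivAt
  have h4 := HasFDerivAt.comp (f := fun z : Ambient n => ‖y‖⁻¹ • z) y h3 h2
  rw [← h1] at h4
  rw [h4.fderiv]
  ext1 v
  simp

/-! ### Covariant derivatives in terms of flat derivatives -/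

lemma inner_tangentProj (x : Sph n) (v : Ambient n) : ⟪(x : Ambient n), tangentProj x v⟫ = 0 := by
  simp [tangentProj, inner_sub_right, inner_smul_right]

lemma tangentProj_tangentProj (x : Sph n) (v : Ambient n) :
    tangentProj x (tangentProj x v) = tangentProj x v := by
  conv_lhs => rw [tangentProj, inner_tangentProj]
  simp

lemma tangentProj_smul (x : Sph n) (r : ℝ) (v : Ambient n) :
    tangentProj x (r • v) = r • tangentProj x v := by
  simp [tangentProj, inner_smul_right, smul_sub, smul_smul]

lemma tangentProj_sub (x : Sph n) (v w : Ambient n) :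
    tangentProj x (v - w) = tangentProj x v - tangentProj x w := by
  simp [tangentProj, inner_sub_right, sub_smul]; abel

lemma hasFDerivAt_tangentField (b x : Ambient n) :
    HasFDerivAt (fun y : Ambient n => b - ⟪y, b⟫ • y)
      (-(⟪x, b⟫ • ContinuousLinearMap.id ℝ (Ambient n)
        + (innerSL ℝ b).smulRight x)) x := by
  have h1 : HasFDerivAt (fun y : Ambient n => ⟪y, b⟫) (innerSL ℝ b) x :=
    (innerSL ℝ b).hasFDerivAt.congr_of_eventuallyEq
      (Filter.Eventually.of_forall fun y => real_inner_comm b y)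
  exact (h1.smul (hasFDerivAt_id x)).const_sub b

lemma connection_tangentField (U : Sph n → Ambient n) (b : Ambient n) (x : Sph n)
    (hU : ⟪(x : Ambient n), U x⟫ = 0) :
    connection U (tangentField b) x = -(⟪(x : Ambient n), b⟫ • U x) := by
  have h : differential (tangentField b) x (U x)
      = fderiv ℝ (fun y : Ambient n => b - ⟪y, b⟫ • y) x (tangentProj x (U x)) :=
    differential_restrict (hasFDerivAt_tangentField b x).differentiableAt _
  have hP : tangentProj x (U x) = U x := by simp [tangentProj, hU]
  rw [connection, h, (hasFDerivAt_tangentField b x).fderiv, hP]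
  simp [tangentProj, inner_smul_right, inner_add_right, hU]

lemma inner_tangentField (x : Sph n) (a : Ambient n) :
    ⟪(x : Ambient n), tangentField a x⟫ = 0 := inner_tangentProj x a

lemma connection_tangentField_tangentField (a b : Ambient n) (x : Sph n) :
    connection (tangentField a) (tangentField b) x
      = -(⟪(x : Ambient n), b⟫ • tangentProj x a) :=
  connection_tangentField _ b x (inner_tangentField x a)

lemma bracket_tangentField (a b : Ambient n) (x : Sph n) :
    bracket (tangentField a) (tangentField b) x
      = ⟪(x : Ambient n), a⟫ • tangentProj x b - ⟪(x : Ambient n), b⟫ • tangentProj x a := by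
  rw [bracket, connection_tangentField_tangentField, connection_tangentField_tangentField]
  abel

/-- The iterated covariant derivative `∇_a ∇_b c` of the fields of tangential parts of constant
vectors. -/
lemma connection_connection (a b c : Ambient n) (x : Sph n) :
    connection (tangentField a) (connection (tangentField b) (tangentField c)) x
      = (⟪(x : Ambient n), c⟫ * ⟪(x : Ambient n), b⟫) • tangentProj x a
        - ⟪tangentProj x a, c⟫ • tangentProj x b := by
  have hfun : connection (tangentField b) (tangentField c)
      = fun y : Sph n => (fun y : Ambient n => -(⟪y, c⟫ • (b - ⟪y, b⟫ • y))) y := by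
    funext y
    rw [connection_tangentField_tangentField]; rfl
  have hd : HasFDerivAt (fun y : Ambient n => -(⟪y, c⟫ • (b - ⟪y, b⟫ • y)))
      (-(⟪(x : Ambient n), c⟫ • (-(⟪(x : Ambient n), b⟫ • ContinuousLinearMap.id ℝ (Ambient n)
        + (innerSL ℝ b).smulRight (x : Ambient n)))
        + (innerSL ℝ c).smulRight ((b : Ambient n) - ⟪(x : Ambient n), b⟫ • (x : Ambient n))))
      (x : Ambient n) := by
    have h1 : HasFDerivAt (fun y : Ambient n => ⟪y, c⟫) (innerSL ℝ c) (x : Ambient n) :=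
      (innerSL ℝ c).hasFDerivAt.congr_of_eventuallyEq
        (Filter.Eventually.of_forall fun y => real_inner_comm c y)
    exact (h1.smul (hasFDerivAt_tangentField b (x : Ambient n))).neg
  rw [connection, hfun, differential_restrict hd.differentiableAt, hd.fderiv]
  have hP : tangentProj x (tangentField a x) = tangentProj x a := tangentProj_tangentProj x a
  rw [hP]
  have hi := inner_tangentProj x a
  have hb : b - ⟪(x : Ambient n), b⟫ • (x : Ambient n) = tangentProj x b := rfl
  simp only [hb]
  simp [tangentProj, inner_sub_right, inner_smul_right, inner_add_right, smul_sub, smul_smul,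
    inner_sub_left, inner_smul_left, real_inner_comm, sub_smul]
  module

lemma curvature_eq (x : Sph n) (a b c : Ambient n) :
    curvature x a b c
      = ⟪tangentProj x b, c⟫ • tangentProj x a - ⟪tangentProj x a, c⟫ • tangentProj x b := by
  have hU : ⟪(x : Ambient n), bracket (tangentField a) (tangentField b) x⟫ = 0 := by
    rw [bracket_tangentField, inner_sub_right, inner_smul_right, inner_smul_right,
      inner_tangentProj, inner_tangentProj]
    simp
  rw [curvature, connection_connection, connection_connection, connection_tangentField _ _ _ hU,
    bracket_tangentField]
  module

lemma sum_inner_frame (a b : Ambient n) :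
    ∑ i, ⟪a, frame i⟫ * ⟪b, frame i⟫ = ⟪a, b⟫ := by
  rw [← (EuclideanSpace.basisFun (Fin (n + 1)) ℝ).sum_inner_mul_inner a b]
  refine Finset.sum_congr rfl fun i _ => ?_
  rw [real_inner_comm b]; rfl

lemma inner_frame (i j : Fin (n + 1)) :
    ⟪(frame i : Ambient n), frame j⟫ = if i = j then 1 else 0 :=
  (orthonormal_iff_ite.1 (EuclideanSpace.basisFun (Fin (n + 1)) ℝ).orthonormal) i j

lemma metric_eq (x : Sph n) (a b : Ambient n) :
    metric x a b = ⟪a, b⟫ - ⟪(x : Ambient n), a⟫ * ⟪(x : Ambient n), b⟫ := by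
  simp [metric, tangentProj, inner_sub_left, inner_sub_right, inner_smul_left, inner_smul_right,
    real_inner_comm (x : Ambient n)]

lemma sum_metric_frame (x : Sph n) : ∑ i, metric x (frame i) (frame i) = n := by
  simp only [metric_eq, Finset.sum_sub_distrib, sum_inner_frame, inner_frame, inner_coe_self]
  simp

/-- The scalar curvature of the unit sphere is `n (n - 1)`. -/
lemma scalarCurvature_eq (x : Sph n) : scalarCurvature x = (n : ℝ) * (n - 1) := by
  have key : ∀ i j, metric x (curvature x (frame i) (frame j) (frame j)) (frame i)
      = metric x (frame j) (frame j) * metric x (frame i) (frame i)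
        - metric x (frame i) (frame j) * metric x (frame i) (frame j) := by
    intro i j
    have h1 : ∀ a b : Ambient n, ⟪tangentProj x a, b⟫ = metric x a b := by
      intro a b
      rw [metric_eq]; simp [tangentProj, inner_sub_left, inner_smul_left]
    have h2 : ∀ a b : Ambient n, ⟪tangentProj x a, tangentProj x b⟫ = metric x a b :=
      fun _ _ => rfl
    rw [curvature_eq, metric, tangentProj_sub, tangentProj_smul, tangentProj_smul,
      tangentProj_tangentProj, tangentProj_tangentProj, inner_sub_left, inner_smul_left,
      inner_smul_left, h2, h2, h1, h1]
    simp only [conj_trivial]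
    rw [metric_eq x (frame j) (frame i), metric_eq x (frame i) (frame j),
      real_inner_comm (frame i) (frame j)]
    ring
  have h3 : ∀ i, ∑ j, metric x (frame i) (frame j) * metric x (frame i) (frame j)
      = metric x (frame i) (frame i) := by
    intro i
    have h4 : ∀ b : Ambient n, metric x (frame i) b = ⟪tangentProj x (frame i), b⟫ := by
      intro b
      rw [metric_eq]; simp [tangentProj, inner_sub_left, inner_smul_left]
    simp only [h4, sum_inner_frame]
    exact h4 (frame i) ▸ rfl
  simp only [scalarCurvature, key, Finset.sum_sub_distrib, h3, ← Finset.sum_mul, sum_metric_frame,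
    ← Finset.mul_sum]
  ring

/-! ### Traces over orthonormal bases -/

lemma sum_inner_frame_clm (L : Ambient n →L[ℝ] F) (a : Ambient n) :
    ∑ i, ⟪a, frame i⟫ • L (frame i) = L a := by
  conv_rhs => rw [← (EuclideanSpace.basisFun (Fin (n + 1)) ℝ).sum_repr' a]
  rw [map_sum]
  refine Finset.sum_congr rfl fun i _ => ?_
  rw [map_smul, real_inner_comm]; rfl

/-- The trace of a bilinear form can be computed in any orthonormal basis. -/
lemma sum_bilin_basis {ι : Type*} [Fintype ι] (b : OrthonormalBasis ι ℝ (Ambient n))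
    (B : Ambient n →L[ℝ] Ambient n →L[ℝ] ℝ) :
    ∑ k, B (b k) (b k) = ∑ i, B (frame i) (frame i) := by
  have h1 : ∀ k, B (b k) (b k) = ∑ i, ⟪frame i, b k⟫ * B (frame i) (b k) := by
    intro k
    have h := congrArg (fun L : Ambient n →L[ℝ] ℝ => L (b k)) (sum_inner_frame_clm B (b k))
    simp only [sum_apply, smul_apply, smul_eq_mul] at h
    rw [← h]
    exact Finset.sum_congr rfl fun i _ => by rw [real_inner_comm]
  simp only [h1]
  rw [Finset.sum_comm]
  refine Finset.sum_congr rfl fun i _ => ?_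
  have h2 : B (frame i) (∑ k, ⟪b k, (frame i : Ambient n)⟫ • b k) = B (frame i) (frame i) := by
    rw [b.sum_repr']
  rw [← h2, map_sum]
  exact Finset.sum_congr rfl fun k _ => by rw [map_smul, smul_eq_mul, real_inner_comm]

/-- The squared norm of a bilinear form can be computed in any orthonormal basis. -/
lemma sum_sq_basis {ι : Type*} [Fintype ι] (b : OrthonormalBasis ι ℝ (Ambient n))
    (B : Ambient n →L[ℝ] Ambient n →L[ℝ] ℝ) :
    ∑ k, ∑ l, B (b k) (b l) ^ 2 = ∑ i, ∑ j, B (frame i) (frame j) ^ 2 := by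
  have h : ∀ L : Ambient n →L[ℝ] ℝ, ∑ l, L (b l) ^ 2 = ∑ j, L (frame j) ^ 2 := by
    intro L
    simpa [sq] using sum_bilin_basis b (L.smulRight L)
  simp only [h]
  rw [Finset.sum_comm]
  conv_rhs => rw [Finset.sum_comm]
  exact Finset.sum_congr rfl fun j _ => h (B.flip (frame j))

/-- The orthonormal basis obtained from the standard one by applying an isometry. -/
noncomputable def rotatedBasis (A : Ambient n ≃ₗᵢ[ℝ] Ambient n) :
    OrthonormalBasis (Fin (n + 1)) ℝ (Ambient n) :=
  (EuclideanSpace.basisFun (Fin (n + 1)) ℝ).map A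

lemma rotatedBasis_apply (A : Ambient n ≃ₗᵢ[ℝ] Ambient n) (i : Fin (n + 1)) :
    rotatedBasis A i = A (frame i) := by
  simp [rotatedBasis, frame]

/-! ### Tensor fields and their covariant derivatives -/

lemma SphDiff.clm₂ {G H : Type*} [NormedAddCommGroup G] [NormedSpace ℝ G] [NormedAddCommGroup H]
    [NormedSpace ℝ H] {k : WithTop ℕ∞} {f : Sph n → F} {g : Sph n → G} (B : F →L[ℝ] G →L[ℝ] H)
    (hf : SphDiff k f) (hg : SphDiff k g) : SphDiff k (fun x => B (f x) (g x)) := by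
  refine ((B.contDiff.comp_contDiffOn hf).clm_apply hg).congr fun y hy => ?_
  simp [rayExtension_of_ne _ hy]

lemma differential_apply {k : WithTop ℕ∞} (hk : k ≠ 0) {W : Sph n → Ambient n →L[ℝ] F}
    (hW : SphDiff k W) (x : Sph n) (v a : Ambient n) :
    differential (fun y => W y a) x v = differential W x v a :=
  differential_clm hk (ContinuousLinearMap.apply ℝ F a) hW x v

lemma differential_apply₂ {k : WithTop ℕ∞} (hk : k ≠ 0)
    {B : Sph n → Ambient n →L[ℝ] Ambient n →L[ℝ] F}
    (hB : SphDiff k B) (x : Sph n) (v a b : Ambient n) :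
    differential (fun y => B y a b) x v = differential B x v a b := by
  rw [differential_apply (W := fun y => B y a) hk
    (hB.clm (ContinuousLinearMap.apply ℝ _ a)), differential_apply hk hB]

lemma isOneForm_differential {k : WithTop ℕ∞} (hk : k ≠ 0) {f : Sph n → ℝ} (hf : SphDiff k f) :
    IsOneForm (differential f) := fun x => differential_self hk hf x

lemma IsOneForm.apply_tangentProj {W : Sph n → Ambient n →L[ℝ] ℝ} (hW : IsOneForm W)
    (x : Sph n) (a : Ambient n) : W x (tangentProj x a) = W x a := by
  simp [tangentProj, hW x]

/-- The covariant derivative of a `1`-form is the flat derivative of its extension along rays, up to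
a correction by the second fundamental form that makes it tangential in the second argument. -/
lemma covOneForm_eq {k : WithTop ℕ∞} (hk : k ≠ 0) {W : Sph n → Ambient n →L[ℝ] ℝ}
    (hW : IsOneForm W) (hs : SphDiff k W) (x : Sph n) (a b : Ambient n) :
    covOneForm W x a b = differential W x a b + ⟪(x : Ambient n), b⟫ * W x a := by
  have h : (fun y => W y (tangentField b y)) = fun y => W y b := by
    funext y; exact hW.apply_tangentProj y b
  rw [covOneForm, h, connection_tangentField_tangentField, differential_apply hk hs, tangentField,
    differential_tangentProj hk hs, map_neg, map_smul, hW.apply_tangentProj]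
  simp

lemma divOneForm_eq {k : WithTop ℕ∞} (hk : k ≠ 0) {W : Sph n → Ambient n →L[ℝ] ℝ}
    (hW : IsOneForm W) (hs : SphDiff k W) (x : Sph n) :
    divOneForm W x = ∑ i, differential W x (frame i) (frame i) := by
  have h : ∑ i, ⟪(x : Ambient n), frame i⟫ * W x (frame i) = 0 := by
    have := sum_inner_frame_clm (W x) (x : Ambient n)
    rw [hW x] at this
    simpa using this
  simp only [divOneForm, covOneForm_eq hk hW hs, Finset.sum_add_distrib, h, add_zero]

/-- A field of bilinear forms on the tangent spaces, each of them being extended by zero to the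
normal line. -/
structure IsTangential (B : Sph n → Ambient n →L[ℝ] Ambient n →L[ℝ] ℝ) : Prop where
  left : ∀ x : Sph n, B x (x : Ambient n) = 0
  right : ∀ (x : Sph n) (a : Ambient n), B x a (x : Ambient n) = 0

lemma IsTangential.apply_tangentProj {B : Sph n → Ambient n →L[ℝ] Ambient n →L[ℝ] ℝ}
    (hB : IsTangential B) (x : Sph n) (a b : Ambient n) :
    B x (tangentProj x a) (tangentProj x b) = B x a b := by
  simp [tangentProj, hB.left x, hB.right x]

/-- The analogue of `covOneForm_eq` for two-tensors, with one correction term for each of the two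
arguments. -/
lemma covTwoTensor_eq {k : WithTop ℕ∞} (hk : k ≠ 0)
    {B : Sph n → Ambient n →L[ℝ] Ambient n →L[ℝ] ℝ}
    (hB : IsTangential B) (hs : SphDiff k B) (x : Sph n) (a b c : Ambient n) :
    covTwoTensor (fun x a b => B x a b) x a b c = differential B x a b c
      + ⟪(x : Ambient n), b⟫ * B x a c + ⟪(x : Ambient n), c⟫ * B x b a := by
  have h : (fun y => B y (tangentField b y) (tangentField c y)) = fun y => B y b c := by
    funext y; exact hB.apply_tangentProj y b c
  rw [covTwoTensor, h, connection_tangentField_tangentField, connection_tangentField_tangentField,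
    differential_apply₂ hk hs, tangentField, tangentField, tangentField,
    differential_tangentProj hk hs]
  simp only [map_neg, map_smul, neg_apply, smul_apply,
    hB.apply_tangentProj, smul_eq_mul]
  ring

/-- For a trace-free tensor both correction terms drop out of the divergence. -/
lemma divTwoTensor_eq {k : WithTop ℕ∞} (hk : k ≠ 0)
    {B : Sph n → Ambient n →L[ℝ] Ambient n →L[ℝ] ℝ}
    (hB : IsTangential B) (hs : SphDiff k B) (x : Sph n)
    (htr : ∑ i, B x (frame i) (frame i) = 0) (b : Ambient n) :
    divTwoTensor (fun x a b => B x a b) x b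
      = ∑ i, differential B x (frame i) (frame i) b := by
  have h : ∑ i, ⟪(x : Ambient n), frame i⟫ * B x (frame i) b = 0 := by
    have := congrArg (fun L : Ambient n →L[ℝ] ℝ => L b)
      (sum_inner_frame_clm (B x) (x : Ambient n))
    rw [hB.left x] at this
    simpa using this
  simp only [divTwoTensor, covTwoTensor_eq hk hB hs, Finset.sum_add_distrib, h,
    ← Finset.mul_sum, htr]
  ring

/-- The inner product of `ℝⁿ⁺¹` as a continuous bilinear form. -/
noncomputable def innerForm (n : ℕ) : Ambient n →L[ℝ] Ambient n →L[ℝ] ℝ :=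
  LinearMap.mkContinuous₂ (innerₗ (Ambient n)) 1 fun a b => by
    simpa using norm_inner_le_norm (𝕜 := ℝ) a b

@[simp] lemma innerForm_apply (a b : Ambient n) : innerForm n a b = ⟪a, b⟫ := rfl

/-- Exchanging the arguments of a bilinear form, as a continuous linear map. -/
noncomputable def flipCLM (n : ℕ) (F : Type*) [NormedAddCommGroup F] [NormedSpace ℝ F] :
    (Ambient n →L[ℝ] Ambient n →L[ℝ] F) →L[ℝ] Ambient n →L[ℝ] Ambient n →L[ℝ] F :=
  (ContinuousLinearMap.flipₗᵢ ℝ (Ambient n) (Ambient n) F).toContinuousLinearEquiv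

/-- The conformal Killing operator as a field of continuous bilinear forms on `ℝⁿ⁺¹`. -/
noncomputable def killingForm (W : Sph n → Ambient n →L[ℝ] ℝ) (x : Sph n) :
    Ambient n →L[ℝ] Ambient n →L[ℝ] ℝ :=
  differential W x + (differential W x).flip
    + (W x).smulRight (innerForm n (x : Ambient n)) + (innerForm n (x : Ambient n)).smulRight (W x)
    - (2 / (n : ℝ) * ∑ i, differential W x (frame i) (frame i)) •
      (innerForm n - (innerForm n (x : Ambient n)).smulRight (innerForm n (x : Ambient n)))

lemma killingForm_apply (W : Sph n → Ambient n →L[ℝ] ℝ) (x : Sph n) (a b : Ambient n) :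
    killingForm W x a b = differential W x a b + differential W x b a
      + ⟪(x : Ambient n), b⟫ * W x a + ⟪(x : Ambient n), a⟫ * W x b
      - 2 / (n : ℝ) * (∑ i, differential W x (frame i) (frame i)) * metric x a b := by
  rw [metric_eq]
  simp [killingForm]
  ring

lemma conformalKilling_eq {k : WithTop ℕ∞} (hk : k ≠ 0) {W : Sph n → Ambient n →L[ℝ] ℝ}
    (hW : IsOneForm W) (hs : SphDiff k W) :
    conformalKilling W = fun x a b => killingForm W x a b := by
  funext x a b
  rw [killingForm_apply, conformalKilling, covOneForm_eq hk hW hs, covOneForm_eq hk hW hs,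
    divOneForm_eq hk hW hs]
  ring

lemma SphDiff.const {k : WithTop ℕ∞} (c : F) : SphDiff k (fun _ : Sph n => c) :=
  SphDiff.restrict contDiffOn_const

lemma SphDiff.sum {ι : Type*} {k : WithTop ℕ∞} {s : Finset ι} {f : ι → Sph n → F}
    (hf : ∀ i ∈ s, SphDiff k (f i)) : SphDiff k (fun x => ∑ i ∈ s, f i x) := by
  refine (ContDiffOn.sum (f := fun i => rayExtension (f i)) hf).congr fun y hy => ?_
  simp [rayExtension_of_ne _ hy]

lemma SphDiff.killingForm {W : Sph n → Ambient n →L[ℝ] ℝ} (hs : SphDiff 2 W) :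
    SphDiff 1 (killingForm W) := by
  have hD : SphDiff 1 (RoundSphere.differential W) :=
    SphDiff.differential (k := 1) (by simpa [one_add_one_eq_two] using hs)
  have hI : SphDiff 1 (fun x : Sph n => innerForm n (x : Ambient n)) :=
    SphDiff.restrict (innerForm n).contDiff.contDiffOn
  have hW : SphDiff 1 W := hs.of_le one_le_two
  have hflip := SphDiff.clm (G := Ambient n →L[ℝ] Ambient n →L[ℝ] ℝ) (flipCLM n ℝ) hD
  have htr : SphDiff 1 (fun x => 2 / (n : ℝ) *
      ∑ i, RoundSphere.differential W x (frame i) (frame i)) := by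
    refine (SphDiff.const (2 / (n : ℝ))).smul (SphDiff.sum fun i _ => ?_)
    exact (hD.clm (ContinuousLinearMap.apply ℝ _ (frame i))).clm
      (ContinuousLinearMap.apply ℝ ℝ (frame i))
  have hmul : ∀ U V : Sph n → Ambient n →L[ℝ] ℝ, SphDiff 1 U → SphDiff 1 V →
      SphDiff 1 (fun x => (U x).smulRight (V x)) := fun U V hU hV =>
    SphDiff.clm₂ (H := Ambient n →L[ℝ] Ambient n →L[ℝ] ℝ)
      (ContinuousLinearMap.smulRightL ℝ (Ambient n) (Ambient n →L[ℝ] ℝ)) hU hV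
  have h1 := hmul _ _ hW hI
  have h2 := hmul _ _ hI hW
  have h3 := hmul _ _ hI hI
  have h4 : SphDiff 1 (fun _ : Sph n => innerForm n) :=
    SphDiff.const _
  exact (((hD.add hflip).add h1).add h2).sub (htr.smul (h4.sub h3))

lemma killingForm_symm (W : Sph n → Ambient n →L[ℝ] ℝ) (x : Sph n) (a b : Ambient n) :
    killingForm W x a b = killingForm W x b a := by
  rw [killingForm_apply, killingForm_apply, metric_eq, metric_eq, real_inner_comm a b]
  ring

/-- Differentiating `W x x = 0`. -/
lemma IsOneForm.differential_apply_self {k : WithTop ℕ∞} (hk : k ≠ 0)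
    {W : Sph n → Ambient n →L[ℝ] ℝ}
    (hW : IsOneForm W) (hs : SphDiff k W) (x : Sph n) (a : Ambient n) :
    differential W x a (x : Ambient n) = - W x a := by
  have h0 : (fun y : Ambient n => rayExtension W y y) = fun _ => 0 := by
    funext y
    by_cases hy : y = 0
    · simp [hy]
    · have := hW (unit y hy)
      rw [unit, map_smul] at this
      rw [rayExtension_of_ne _ hy]
      exact (smul_eq_zero.1 this).resolve_left (inv_ne_zero (norm_ne_zero_iff.2 hy))
  have h1 := (hs.differentiableAt hk (coe_ne_zero x)).hasFDerivAt.clm_apply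
    (hasFDerivAt_id (x : Ambient n))
  have h2 := congrArg (fun L : Ambient n →L[ℝ] ℝ => L a)
    (h1.unique (h0 ▸ hasFDerivAt_const (0 : ℝ) (x : Ambient n)))
  simp only [rayExtension_coe, id_eq] at h2
  simp only [add_apply, ContinuousLinearMap.comp_apply,
    ContinuousLinearMap.flip_apply, ContinuousLinearMap.id_apply,
    zero_apply] at h2
  rw [differential]
  linarith

lemma killingForm_isTangential {k : WithTop ℕ∞} (hk : k ≠ 0) {W : Sph n → Ambient n →L[ℝ] ℝ}
    (hW : IsOneForm W) (hs : SphDiff k W) : IsTangential (killingForm W) := by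
  have h : ∀ (x : Sph n) (a : Ambient n), killingForm W x a (x : Ambient n) = 0 := by
    intro x a
    rw [killingForm_apply, hW.differential_apply_self hk hs, differential_self hk hs, metric_eq,
      hW x, inner_coe_self, real_inner_comm]
    simp
  refine ⟨fun x => ?_, h⟩
  ext1 a
  rw [killingForm_symm, h]; rfl

lemma killingForm_trace (hn : n ≠ 0) {W : Sph n → Ambient n →L[ℝ] ℝ}
    (hW : IsOneForm W) (x : Sph n) :
    ∑ i, killingForm W x (frame i) (frame i) = 0 := by
  have h : ∑ i, ⟪(x : Ambient n), frame i⟫ * W x (frame i) = 0 := by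
    have := sum_inner_frame_clm (W x) (x : Ambient n)
    rw [hW x] at this
    simpa using this
  simp only [killingForm_apply, Finset.sum_add_distrib, Finset.sum_sub_distrib, h,
    ← Finset.mul_sum, sum_metric_frame]
  have : (n : ℝ) ≠ 0 := Nat.cast_ne_zero.2 hn
  field_simp
  ring

lemma differential_sub {k : WithTop ℕ∞} (hk : k ≠ 0) {f g : Sph n → F}
    (hf : SphDiff k f) (hg : SphDiff k g) (x : Sph n) :
    differential (fun x => f x - g x) x = differential f x - differential g x := by
  have h0 : rayExtension (fun x => f x - g x) = rayExtension f - rayExtension g := by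
    funext y
    by_cases hy : y = 0
    · simp [rayExtension, hy]
    · simp [rayExtension_of_ne _ hy]
  rw [differential, h0, fderiv_sub (hf.differentiableAt hk (coe_ne_zero x))
    (hg.differentiableAt hk (coe_ne_zero x))]
  rfl

lemma killingForm_sub {k : WithTop ℕ∞} (hk : k ≠ 0) {V W : Sph n → Ambient n →L[ℝ] ℝ}
    (hV : SphDiff k V) (hW : SphDiff k W) (x : Sph n) :
    killingForm (fun x => V x - W x) x = killingForm V x - killingForm W x := by
  ext a b
  simp only [sub_apply, killingForm_apply, differential_sub hk hV hW, Finset.sum_sub_distrib]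
  ring

/-! ### Invariance under isometries of the sphere -/

@[simp] lemma coe_rotate (A : Ambient n ≃ₗᵢ[ℝ] Ambient n) (x : Sph n) :
    (rotate A x : Ambient n) = A x := rfl

lemma rayExtension_rotate {G : Type*} [NormedAddCommGroup G] (A : Ambient n ≃ₗᵢ[ℝ] Ambient n)
    (f : Sph n → G) : rayExtension (f ∘ rotate A) = rayExtension f ∘ A := by
  funext y
  by_cases hy : y = 0
  · simp [rayExtension, hy]
  · have hA : A y ≠ 0 := by simpa using hy
    rw [Function.comp_apply, rayExtension_of_ne _ hy, rayExtension_of_ne _ hA, Function.comp_apply]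
    congr 1
    ext1
    simp [unit]

lemma differential_rotate (A : Ambient n ≃ₗᵢ[ℝ] Ambient n) (f : Sph n → F) (x : Sph n)
    (v : Ambient n) :
    differential (f ∘ rotate A) x v = differential f (rotate A x) (A v) := by
  have h := A.toContinuousLinearEquiv.comp_right_fderiv (f := rayExtension f) (x := (x : Ambient n))
  have h' : rayExtension (f ∘ rotate A) = rayExtension f ∘ A.toContinuousLinearEquiv :=
    rayExtension_rotate A f
  rw [differential, h', h]
  rfl

lemma contMDiff_rotate (A : Ambient n ≃ₗᵢ[ℝ] Ambient n) (k : WithTop ℕ∞) :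
    ContMDiff (𝓡 n) (𝓡 n) k (rotate A) := by
  have : Fact (Module.finrank ℝ (Ambient n) = n + 1) := ⟨by simp⟩
  have h : ContMDiff (𝓡 n) 𝓘(ℝ, Ambient n) k (fun x : Sph n => A (x : Ambient n)) :=
    A.contDiff.contMDiff.comp contMDiff_coe_sphere
  exact h.codRestrict_sphere (n := n) (fun x => (rotate A x).2)

/-- The pullback `A^* W` of a `1`-form by an isometry. -/
noncomputable def pullForm (A : Ambient n ≃ₗᵢ[ℝ] Ambient n) (W : Sph n → Ambient n →L[ℝ] ℝ)
    (x : Sph n) : Ambient n →L[ℝ] ℝ :=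
  (W (rotate A x)).comp (A.toContinuousLinearEquiv : Ambient n →L[ℝ] Ambient n)

lemma pullForm_apply (A : Ambient n ≃ₗᵢ[ℝ] Ambient n) (W : Sph n → Ambient n →L[ℝ] ℝ)
    (x : Sph n) (v : Ambient n) : pullForm A W x v = W (rotate A x) (A v) := rfl

lemma contMDiff_pullForm (A : Ambient n ≃ₗᵢ[ℝ] Ambient n) {k : WithTop ℕ∞}
    {W : Sph n → Ambient n →L[ℝ] ℝ}
    (hW : ContMDiff (𝓡 n) 𝓘(ℝ, Ambient n →L[ℝ] ℝ) k W) :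
    ContMDiff (𝓡 n) 𝓘(ℝ, Ambient n →L[ℝ] ℝ) k (pullForm A W) := by
  let L : (Ambient n →L[ℝ] ℝ) →L[ℝ] (Ambient n →L[ℝ] ℝ) :=
    (ContinuousLinearMap.compL ℝ (Ambient n) (Ambient n) ℝ).flip
      (A.toContinuousLinearEquiv : Ambient n →L[ℝ] Ambient n)
  exact L.contDiff.contMDiff.comp (hW.comp (contMDiff_rotate A k))

lemma isOneForm_pullForm (A : Ambient n ≃ₗᵢ[ℝ] Ambient n) {W : Sph n → Ambient n →L[ℝ] ℝ}
    (hW : IsOneForm W) : IsOneForm (pullForm A W) := fun x => hW (rotate A x)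

lemma SphDiff.rotate {k : WithTop ℕ∞} {f : Sph n → F} (hf : SphDiff k f)
    (A : Ambient n ≃ₗᵢ[ℝ] Ambient n) : SphDiff k (f ∘ rotate A) := by
  rw [SphDiff, rayExtension_rotate]
  refine ContDiffOn.comp hf A.contDiff.contDiffOn fun y hy => ?_
  simpa using hy

lemma SphDiff.pullForm {k : WithTop ℕ∞} {W : Sph n → Ambient n →L[ℝ] ℝ} (hW : SphDiff k W)
    (A : Ambient n ≃ₗᵢ[ℝ] Ambient n) : SphDiff k (pullForm A W) :=
  (hW.rotate A).clm ((ContinuousLinearMap.compL ℝ (Ambient n) (Ambient n) ℝ).flip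
      (A.toContinuousLinearEquiv : Ambient n →L[ℝ] Ambient n))

lemma differential_pullForm {k : WithTop ℕ∞} (hk : k ≠ 0) {W : Sph n → Ambient n →L[ℝ] ℝ}
    (hW : SphDiff k W) (A : Ambient n ≃ₗᵢ[ℝ] Ambient n) (x : Sph n) (a b : Ambient n) :
    differential (pullForm A W) x a b = differential W (rotate A x) (A a) (A b) := by
  rw [← differential_apply hk (hW.pullForm A), ← differential_apply hk hW, ← differential_rotate]
  rfl

/-- The trace of the pullback of a bilinear form by an isometry. -/
lemma sum_frame_rotate (A : Ambient n ≃ₗᵢ[ℝ] Ambient n)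
    (B : Ambient n →L[ℝ] Ambient n →L[ℝ] ℝ) :
    ∑ i, B (A (frame i)) (A (frame i)) = ∑ i, B (frame i) (frame i) := by
  simpa only [rotatedBasis_apply] using sum_bilin_basis (rotatedBasis A) B

lemma metric_rotate (A : Ambient n ≃ₗᵢ[ℝ] Ambient n) (x : Sph n) (a b : Ambient n) :
    metric (rotate A x) (A a) (A b) = metric x a b := by
  simp [metric_eq]

lemma killingForm_pullForm {k : WithTop ℕ∞} (hk : k ≠ 0) {W : Sph n → Ambient n →L[ℝ] ℝ}
    (hW : SphDiff k W) (A : Ambient n ≃ₗᵢ[ℝ] Ambient n) (x : Sph n) (a b : Ambient n) :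
    killingForm (pullForm A W) x a b = killingForm W (rotate A x) (A a) (A b) := by
  simp only [killingForm_apply, differential_pullForm hk hW, metric_rotate, sum_frame_rotate,
    pullForm_apply, coe_rotate, A.inner_map_map]

lemma sum_sq_killingForm_pullForm {k : WithTop ℕ∞} (hk : k ≠ 0) {W : Sph n → Ambient n →L[ℝ] ℝ}
    (hW : SphDiff k W) (A : Ambient n ≃ₗᵢ[ℝ] Ambient n) (x : Sph n) :
    ∑ i, ∑ j, killingForm (pullForm A W) x (frame i) (frame j) ^ 2
      = ∑ i, ∑ j, killingForm W (rotate A x) (frame i) (frame j) ^ 2 := by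
  simpa only [rotatedBasis_apply, ← killingForm_pullForm hk hW A] using
    sum_sq_basis (rotatedBasis A) (killingForm W (rotate A x))

lemma div_killingForm_pullForm {W : Sph n → Ambient n →L[ℝ] ℝ}
    (hW : SphDiff 2 W) (A : Ambient n ≃ₗᵢ[ℝ] Ambient n) (x : Sph n) (b : Ambient n) :
    ∑ i, differential (killingForm (pullForm A W)) x (frame i) (frame i) b
      = ∑ i, differential (killingForm W) (rotate A x) (frame i) (frame i) (A b) := by
  have h : ∀ i, differential (killingForm (pullForm A W)) x (frame i) (frame i) b
      = differential (killingForm W) (rotate A x) (A (frame i)) (A (frame i)) (A b) := by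
    intro i
    rw [← differential_apply₂ one_ne_zero (hW.pullForm A).killingForm,
      ← differential_apply₂ one_ne_zero hW.killingForm, ← differential_rotate]
    simp only [killingForm_pullForm two_ne_zero hW A]
    rfl
  simp only [h]
  exact sum_frame_rotate A
    (((flipCLM n ℝ).comp (differential (killingForm W) (rotate A x))).flip (A b))

lemma laplacian_eq {f : Sph n → ℝ} (hf : SphDiff 2 f) (x : Sph n) :
    laplacian f x = ∑ i, differential (differential f) x (frame i) (frame i) :=
  divOneForm_eq one_ne_zero (isOneForm_differential two_ne_zero hf)
    (SphDiff.differential (k := 1) (by simpa [one_add_one_eq_two] using hf)) x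

lemma laplacian_rotate {f : Sph n → ℝ} (hf : SphDiff 2 f) (A : Ambient n ≃ₗᵢ[ℝ] Ambient n)
    (x : Sph n) : laplacian (f ∘ rotate A) x = laplacian f (rotate A x) := by
  have h : differential (f ∘ rotate A) = pullForm A (differential f) := by
    funext y; ext v
    exact differential_rotate A f y v
  have hd : SphDiff 1 (differential f) :=
    SphDiff.differential (k := 1) (by simpa [one_add_one_eq_two] using hf)
  rw [laplacian_eq (hf.rotate A), laplacian_eq hf, h]
  simp only [differential_pullForm one_ne_zero hd]
  exact sum_frame_rotate A _

lemma IsRadial.comp_rotate {p : Sph n} {f : Sph n → ℝ} (hf : IsRadial p f)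
    {A : Ambient n ≃ₗᵢ[ℝ] Ambient n} (hA : A (p : Ambient n) = p) : f ∘ rotate A = f := by
  obtain ⟨h, hh⟩ := hf
  funext x
  have : geodesicDist p (rotate A x) = geodesicDist p x := by
    have := A.toLinearIsometry.angle_map (p : Ambient n) (x : Ambient n)
    simp only [LinearIsometryEquiv.coe_toLinearIsometry, hA] at this
    exact this
  rw [Function.comp_apply, hh, hh, this]

/-- The constraint equations, written in terms of flat derivatives. -/
lemma isConformalSolution_iff (hn : n ≠ 0) {k : ℕ∞} {τ φ : Sph n → ℝ}
    {W : Sph n → Ambient n →L[ℝ] ℝ} :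
    IsConformalSolution k τ φ W ↔ (∀ x, 0 < φ x) ∧ ContMDiff (𝓡 n) 𝓘(ℝ, ℝ) k φ ∧ IsOneForm W ∧
      ContMDiff (𝓡 n) 𝓘(ℝ, Ambient n →L[ℝ] ℝ) 2 W ∧
      (∀ x, -(4 * ((n : ℝ) - 1) / ((n : ℝ) - 2)) * laplacian φ x + (n : ℝ) * (n - 1) * φ x
        = -(((n : ℝ) - 1) / n) * τ x ^ 2 * φ x ^ (critExp n - 1)
          + (∑ i, ∑ j, killingForm W x (frame i) (frame j) ^ 2) / φ x ^ (critExp n + 1)) ∧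
      ∀ x : Sph n, ∀ b : Ambient n, ⟪(x : Ambient n), b⟫ = 0 →
        ∑ i, differential (killingForm W) x (frame i) (frame i) b
          = ((n : ℝ) - 1) / n * φ x ^ critExp n * differential τ x b := by
  have key : IsOneForm W → ContMDiff (𝓡 n) 𝓘(ℝ, Ambient n →L[ℝ] ℝ) 2 W →
      (∀ x, normSqTwoTensor (conformalKilling W) x
        = ∑ i, ∑ j, killingForm W x (frame i) (frame j) ^ 2) ∧
      ∀ x b, divTwoTensor (conformalKilling W) x b
        = ∑ i, differential (killingForm W) x (frame i) (frame i) b := by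
    intro h1 h2
    have h3 := SphDiff.of_contMDiff h2
    have h4 := conformalKilling_eq two_ne_zero h1 h3
    refine ⟨fun x => by rw [h4]; rfl, fun x b => ?_⟩
    rw [h4]
    exact divTwoTensor_eq one_ne_zero (killingForm_isTangential two_ne_zero h1 h3) h3.killingForm
      x (killingForm_trace hn h1 x) b
  constructor
  · rintro ⟨h1, h2, h3, h4, h5, h6⟩
    obtain ⟨k1, k2⟩ := key h3 h4
    simp only [k1, scalarCurvature_eq] at h5
    simp only [k2] at h6
    exact ⟨h1, h2, h3, h4, h5, h6⟩
  · rintro ⟨h1, h2, h3, h4, h5, h6⟩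
    obtain ⟨k1, k2⟩ := key h3 h4
    simp only [← k1] at h5
    simp only [← k2] at h6
    exact ⟨h1, h2, h3, h4, fun x => by simpa only [scalarCurvature_eq] using h5 x, h6⟩

/-- The constraint equations are invariant under isometries that preserve the mean curvature. -/
lemma IsConformalSolution.rotate (hn : n ≠ 0) {k : ℕ∞} (hk : 2 ≤ k) {τ φ : Sph n → ℝ}
    {W : Sph n → Ambient n →L[ℝ] ℝ} (h : IsConformalSolution k τ φ W)
    {A : Ambient n ≃ₗᵢ[ℝ] Ambient n} (hA : τ ∘ rotate A = τ) :
    IsConformalSolution k τ (φ ∘ rotate A) (pullForm A W) := by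
  rw [isConformalSolution_iff hn] at h ⊢
  obtain ⟨h1, h2, h3, h4, h5, h6⟩ := h
  have hW := SphDiff.of_contMDiff h4
  have hφ : SphDiff 2 φ := (SphDiff.of_contMDiff h2).of_le (WithTop.coe_le_coe.2 hk)
  refine ⟨fun x => h1 _, h2.comp (contMDiff_rotate A k), isOneForm_pullForm A h3,
    contMDiff_pullForm A h4, fun x => ?_, fun x b hb => ?_⟩
  · have hx : τ x = τ (RoundSphere.rotate A x) := (congrFun hA x).symm
    rw [laplacian_rotate hφ, sum_sq_killingForm_pullForm two_ne_zero hW, hx]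
    exact h5 (RoundSphere.rotate A x)
  · have hx : differential τ x b = differential τ (RoundSphere.rotate A x) (A b) := by
      rw [← differential_rotate, hA]
    rw [div_killingForm_pullForm hW, hx]
    refine h6 (RoundSphere.rotate A x) (A b) ?_
    rw [coe_rotate, A.inner_map_map, hb]

/-! ### Integration by parts on the sphere -/

/-- A smooth bump function on `ℝ` that is positive at `1` and supported in `[1/2, 3/2]`. -/
noncomputable def bump : ContDiffBump (1 : ℝ) := ⟨1 / 4, 1 / 2, by norm_num, by norm_num⟩

lemma bump_eq_zero {t : ℝ} (ht : t ≤ 1 / 2 ∨ 3 / 2 ≤ t) : bump t = 0 := by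
  refine bump.zero_of_le_dist ?_
  rw [Real.dist_eq]
  change 1 / 2 ≤ _
  rcases ht with ht | ht
  · rw [abs_of_nonpos (by linarith)]; linarith
  · rw [abs_of_nonneg (by linarith)]; linarith

/-- A smooth function on `ℝⁿ⁺¹` of `‖y‖`, supported in a spherical shell around the unit sphere. -/
noncomputable def shellCutoff (y : Ambient n) : ℝ := bump (‖y‖ ^ 2)

lemma contDiff_shellCutoff : ContDiff ℝ 1 (shellCutoff (n := n)) :=
  bump.contDiff.comp (contDiff_norm_sq ℝ)

lemma shellCutoff_coe (x : Sph n) : shellCutoff (x : Ambient n) = 1 := by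
  rw [shellCutoff, norm_coe, one_pow]
  exact bump.one_of_mem_closedBall (by simp [bump.rIn_pos.le])

lemma hasFDerivAt_shellCutoff (y : Ambient n) :
    HasFDerivAt (shellCutoff (n := n)) ((2 * deriv bump (‖y‖ ^ 2)) • innerSL ℝ y) y := by
  have h0 : HasFDerivAt (fun y : Ambient n => ‖y‖ ^ 2) (2 • innerSL ℝ y) y :=
    (hasStrictFDerivAt_norm_sq y).hasFDerivAt
  have h1 : HasDerivAt bump (deriv bump (‖y‖ ^ 2)) (‖y‖ ^ 2) :=
    ((bump.contDiff (n := 1)).differentiable one_ne_zero _).hasDerivAt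
  refine (h1.comp_hasFDerivAt y h0).congr_fderiv ?_
  ext v; simp; ring

lemma contDiff_shellCutoff_mul {f : Sph n → ℝ} (hf : SphDiff 1 f) :
    ContDiff ℝ 1 (fun y => shellCutoff y * rayExtension f y) := by
  rw [contDiff_iff_contDiffAt]
  intro y
  by_cases hy : y = 0
  · subst hy
    have : (fun y : Ambient n => shellCutoff y * rayExtension f y) =ᶠ[nhds 0] fun _ => 0 := by
      filter_upwards [Metric.ball_mem_nhds (0 : Ambient n) (show (0 : ℝ) < 1 / 2 by norm_num)]
        with z hz
      rw [shellCutoff, bump_eq_zero (Or.inl ?_), zero_mul]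
      have := mem_ball_zero_iff.1 hz
      nlinarith [norm_nonneg z]
    exact contDiffAt_const.congr_of_eventuallyEq this
  · exact contDiff_shellCutoff.contDiffAt.mul (hf.contDiffAt hy)

lemma hasCompactSupport_shellCutoff_mul (f : Ambient n → ℝ) :
    HasCompactSupport (fun y => shellCutoff y * f y) := by
  refine HasCompactSupport.intro (isCompact_closedBall (0 : Ambient n) 2) fun y hy => ?_
  rw [shellCutoff, bump_eq_zero (Or.inr ?_), zero_mul]
  have : 2 < ‖y‖ := by simpa using hy
  nlinarith

lemma integral_fderiv_eq_zero {G : Ambient n → ℝ} (hG : ContDiff ℝ 1 G)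
    (hc : HasCompactSupport G) (v : Ambient n) : ∫ y, fderiv ℝ G y v = 0 := by
  have h1 : Continuous (fun y => fderiv ℝ G y v) :=
    (hG.continuous_fderiv one_ne_zero).clm_apply continuous_const
  have h2 : HasCompactSupport (fun y => fderiv ℝ G y v) := hc.fderiv_apply ℝ v
  have h := integral_mul_fderiv_eq_neg_fderiv_mul_of_integrable
    (μ := MeasureTheory.volume) (f := fun _ : Ambient n => (1 : ℝ)) (g := G) (v := v)
    (by simp) (by simpa using h1.integrable_of_hasCompactSupport h2)
    (by simpa using hG.continuous.integrable_of_hasCompactSupport hc)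
    (fun x _ => by fun_prop) (fun x _ => hG.differentiable one_ne_zero x)
  simpa using h

/-- The divergence theorem on the sphere, in the form: a tangential vector field (given by its
components) of nonnegative divergence has zero divergence. The field is extended along rays and
multiplied by a radial cutoff function; this leads to a compactly supported vector field on
`ℝⁿ⁺¹`, whose divergence has integral zero. -/
lemma div_eq_zero_of_nonneg {X : Fin (n + 1) → Sph n → ℝ} (hX : ∀ i, SphDiff 1 (X i))
    (ht : ∀ x : Sph n, ∑ i, ⟪(x : Ambient n), frame i⟫ * X i x = 0)
    (hpos : ∀ x, 0 ≤ ∑ i, differential (X i) x (frame i)) (x : Sph n) :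
    ∑ i, differential (X i) x (frame i) = 0 := by
  set G : Fin (n + 1) → Ambient n → ℝ := fun i y => shellCutoff y * rayExtension (X i) y with hGdef
  have hG : ∀ i, ContDiff ℝ 1 (G i) := fun i => contDiff_shellCutoff_mul (hX i)
  have hGc : ∀ i, HasCompactSupport (G i) := fun i => hasCompactSupport_shellCutoff_mul _
  set H : Ambient n → ℝ := fun y => ∑ i, fderiv ℝ (G i) y (frame i) with hHdef
  have hHcont : Continuous H := continuous_finsetSum _ fun i _ =>
    ((hG i).continuous_fderiv one_ne_zero).clm_apply continuous_const
  have hHc : HasCompactSupport H := by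
    refine HasCompactSupport.intro (isCompact_closedBall (0 : Ambient n) 2) fun y hy => ?_
    refine Finset.sum_eq_zero fun i _ => ?_
    have h0 : G i =ᶠ[nhds y] fun _ => 0 := by
      filter_upwards [Metric.isClosed_closedBall.isOpen_compl.mem_nhds hy] with z hz
      have : 2 < ‖z‖ := by simpa using hz
      simp only [hGdef]
      rw [shellCutoff, bump_eq_zero (Or.inr ?_), zero_mul]
      nlinarith
    rw [h0.fderiv_eq]; simp
  have hHint : ∫ y, H y = 0 := by
    rw [hHdef, MeasureTheory.integral_finsetSum]
    · exact Finset.sum_eq_zero fun i _ => integral_fderiv_eq_zero (hG i) (hGc i) _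
    · intro i _
      exact (((hG i).continuous_fderiv one_ne_zero).clm_apply
        continuous_const).integrable_of_hasCompactSupport ((hGc i).fderiv_apply ℝ _)
  have hHval : ∀ (y : Ambient n) (hy : y ≠ 0), H y
      = shellCutoff y * ‖y‖⁻¹ * ∑ i, differential (X i) (unit y hy) (frame i) := by
    intro y hy
    have hi : ∀ i, fderiv ℝ (G i) y (frame i)
        = shellCutoff y * ‖y‖⁻¹ * differential (X i) (unit y hy) (frame i)
          + 2 * deriv bump (‖y‖ ^ 2) * ‖y‖
            * (⟪(unit y hy : Ambient n), frame i⟫ * X i (unit y hy)) := by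
      intro i
      have h1 := (hasFDerivAt_shellCutoff y).mul
        ((hX i).differentiableAt one_ne_zero hy).hasFDerivAt
      have h2 : G i = shellCutoff * rayExtension (X i) := rfl
      have hne := norm_ne_zero_iff.2 hy
      rw [h2, h1.fderiv, fderiv_rayExtension one_ne_zero (hX i) hy, rayExtension_of_ne _ hy]
      simp only [unit, inner_smul_left, add_apply, smul_apply, smul_eq_mul, innerSL_apply_apply,
        conj_trivial]
      field_simp
    simp only [hHdef, hi, Finset.sum_add_distrib, ← Finset.mul_sum, ht, mul_zero, add_zero]
  have hHnn : 0 ≤ H := by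
    intro y
    by_cases hy : y = 0
    · have h0 : ∀ i, G i =ᶠ[nhds y] fun _ => 0 := by
        intro i
        subst hy
        filter_upwards [Metric.ball_mem_nhds (0 : Ambient n) (show (0 : ℝ) < 1 / 2 by norm_num)]
          with z hz
        simp only [hGdef]
        rw [shellCutoff, bump_eq_zero (Or.inl ?_), zero_mul]
        have := mem_ball_zero_iff.1 hz
        nlinarith [norm_nonneg z]
      have : H y = 0 := Finset.sum_eq_zero fun i _ => by rw [(h0 i).fderiv_eq]; simp
      simp [this]
    · rw [hHval y hy]
      exact mul_nonneg (mul_nonneg bump.nonneg (inv_nonneg.2 (norm_nonneg y))) (hpos _)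
  by_contra hne
  have hx : H x ≠ 0 := by
    rw [hHval x (coe_ne_zero x), unit_coe, shellCutoff_coe]
    simpa using hne
  exact (hHcont.integral_pos_of_hasCompactSupport_nonneg_nonzero
    (μ := MeasureTheory.volume) hHc hHnn hx).ne' hHint

/-- The vector dual to a covector. -/
noncomputable def sharp (n : ℕ) : (Ambient n →L[ℝ] ℝ) →L[ℝ] Ambient n :=
  ∑ j, (ContinuousLinearMap.apply ℝ ℝ (frame j)).smulRight (frame j)

lemma sharp_apply (l : Ambient n →L[ℝ] ℝ) : sharp n l = ∑ j, l (frame j) • frame j := by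
  simp [sharp]

lemma inner_sharp (a : Ambient n) (l : Ambient n →L[ℝ] ℝ) : ⟪a, sharp n l⟫ = l a := by
  rw [sharp_apply, inner_sum, ← sum_inner_frame_clm l a]
  exact Finset.sum_congr rfl fun j _ => by rw [inner_smul_right, smul_eq_mul, mul_comm]

lemma differential_clm_apply {k : WithTop ℕ∞} (hk : k ≠ 0) {L : Sph n → Ambient n →L[ℝ] ℝ}
    {V : Sph n → Ambient n} (hL : SphDiff k L) (hV : SphDiff k V) (x : Sph n) (v : Ambient n) :
    differential (fun y => L y (V y)) x v
      = differential L x v (V x) + L x (differential V x v) := by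
  have h0 : rayExtension (fun y => L y (V y)) = fun y => rayExtension L y (rayExtension V y) := by
    funext y
    by_cases hy : y = 0
    · simp [rayExtension, hy]
    · simp [rayExtension_of_ne _ hy]
  have h1 := (hL.differentiableAt hk (coe_ne_zero x)).hasFDerivAt.clm_apply
    (hV.differentiableAt hk (coe_ne_zero x)).hasFDerivAt
  rw [differential, h0, h1.fderiv]
  simp [differential, add_comm]

/-- `∇ⁱ Vʲ` contracted with the conformal Killing operator of `V` is `|LV|² / 2`, because `LV` is
symmetric, trace-free and tangential. -/
lemma sum_killingForm_mul_differential (hn : n ≠ 0) {V : Sph n → Ambient n →L[ℝ] ℝ}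
    (hV : IsOneForm V) (hs : SphDiff 2 V) (x : Sph n) :
    2 * ∑ i, ∑ j, killingForm V x (frame i) (frame j) * differential V x (frame i) (frame j)
      = ∑ i, ∑ j, killingForm V x (frame i) (frame j) ^ 2 := by
  set B := killingForm V x with hB
  have hT := killingForm_isTangential two_ne_zero hV hs
  have hr : ∀ a, ∑ j, ⟪(x : Ambient n), frame j⟫ * B a (frame j) = 0 := by
    intro a
    have := sum_inner_frame_clm (B a) (x : Ambient n)
    rw [hB, hT.right] at this
    simpa using this
  have hsq : ∀ i j, B (frame i) (frame j) ^ 2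
      = B (frame i) (frame j) * differential V x (frame i) (frame j)
        + B (frame j) (frame i) * differential V x (frame j) (frame i)
        + V x (frame i) * (⟪(x : Ambient n), frame j⟫ * B (frame i) (frame j))
        + V x (frame j) * (⟪(x : Ambient n), frame i⟫ * B (frame j) (frame i))
        - 2 / (n : ℝ) * (∑ i, differential V x (frame i) (frame i))
          * (B (frame i) (frame j) * (if i = j then 1 else 0))
        + 2 / (n : ℝ) * (∑ i, differential V x (frame i) (frame i))
          * (⟪(x : Ambient n), frame i⟫
            * (⟪(x : Ambient n), frame j⟫ * B (frame i) (frame j))) := by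
    intro i j
    have h1 : B (frame j) (frame i) = B (frame i) (frame j) := killingForm_symm V x _ _
    have h2 := killingForm_apply V x (frame i) (frame j)
    rw [metric_eq, inner_frame, ← hB] at h2
    rw [h1]
    linear_combination B (frame i) (frame j) * h2
  have hc : ∀ f : Fin (n + 1) → Fin (n + 1) → ℝ, ∑ i, ∑ j, f j i = ∑ i, ∑ j, f i j :=
    fun f => Finset.sum_comm
  have h3 : ∑ i, ∑ j, V x (frame j) * (⟪(x : Ambient n), frame i⟫ * B (frame j) (frame i)) = 0 := by
    rw [hc fun i j => V x (frame i) * (⟪(x : Ambient n), frame j⟫ * B (frame i) (frame j))]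
    simp [← Finset.mul_sum, hr]
  simp only [hsq, Finset.sum_add_distrib, Finset.sum_sub_distrib, h3,
    hc fun i j => B (frame i) (frame j) * differential V x (frame i) (frame j)]
  simp only [← Finset.mul_sum, hr]
  simp only [mul_ite, mul_one, mul_zero, Finset.sum_ite_eq, Finset.mem_univ, if_true,
    Finset.sum_const_zero]
  rw [hB, killingForm_trace hn hV]
  ring

/-- A `1`-form `V` with `div LV = 0` satisfies `LV = 0`: the divergence of the vector field
`(LV)(·, V)` is `|LV|² / 2`. -/
lemma killingForm_eq_zero (hn : n ≠ 0) {V : Sph n → Ambient n →L[ℝ] ℝ}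
    (hV : IsOneForm V) (hs : SphDiff 2 V)
    (hdiv : ∀ (x : Sph n) (b : Ambient n), ⟪(x : Ambient n), b⟫ = 0 →
      ∑ i, differential (killingForm V) x (frame i) (frame i) b = 0) (x : Sph n) :
    killingForm V x = 0 := by
  have hT := killingForm_isTangential two_ne_zero hV hs
  have hB := hs.killingForm
  have hs1 : SphDiff 1 V := hs.of_le one_le_two
  have hBi : ∀ i, SphDiff 1 (fun x => killingForm V x (frame i)) := fun i =>
    hB.clm (ContinuousLinearMap.apply ℝ _ (frame i))
  have hsV : SphDiff 1 (fun x => sharp n (V x)) := hs1.clm (sharp n)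
  have hdivX : ∀ x,
      ∑ i, differential (fun x => killingForm V x (frame i) (sharp n (V x))) x (frame i)
      = (∑ i, ∑ j, killingForm V x (frame i) (frame j) ^ 2) / 2 := by
    intro x
    rw [← sum_killingForm_mul_differential hn hV hs]
    have h1 : ∀ i, differential (fun x => killingForm V x (frame i) (sharp n (V x))) x (frame i)
        = differential (killingForm V) x (frame i) (frame i) (sharp n (V x))
          + ∑ j, killingForm V x (frame i) (frame j) * differential V x (frame i) (frame j) := by
      intro i
      rw [differential_clm_apply one_ne_zero (hBi i) hsV, differential_apply one_ne_zero hB,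
        differential_clm one_ne_zero (sharp n) hs1, sharp_apply (differential V x (frame i)),
        map_sum]
      simp [mul_comm]
    simp only [h1, Finset.sum_add_distrib]
    rw [hdiv x _ (by rw [inner_sharp, hV x])]
    ring
  have h := div_eq_zero_of_nonneg
    (X := fun i x => killingForm V x (frame i) (sharp n (V x)))
    (fun i => SphDiff.clm₂ (ContinuousLinearMap.id ℝ (Ambient n →L[ℝ] ℝ)) (hBi i) hsV) ?_ ?_ x
  · rw [hdivX] at h
    have h2 : ∑ i, ∑ j, killingForm V x (frame i) (frame j) ^ 2 = 0 := by linarith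
    have h3 : ∀ i j, killingForm V x (frame i) (frame j) = 0 := by
      intro i j
      have h4 := (Finset.sum_eq_zero_iff_of_nonneg
        (fun i _ => Finset.sum_nonneg fun j _ => sq_nonneg _)).1 h2 i (Finset.mem_univ i)
      have h5 := (Finset.sum_eq_zero_iff_of_nonneg (fun j _ => sq_nonneg _)).1 h4 j
        (Finset.mem_univ j)
      exact pow_eq_zero_iff two_ne_zero |>.1 h5
    ext a b
    rw [← sum_inner_frame_clm (killingForm V x) a]
    simp only [sum_apply, smul_apply, zero_apply]
    refine Finset.sum_eq_zero fun i _ => ?_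
    rw [← sum_inner_frame_clm (killingForm V x (frame i)) b]
    simp [h3]
  · intro x
    have := congrArg (fun L : Ambient n →L[ℝ] ℝ => L (sharp n (V x)))
      (sum_inner_frame_clm (killingForm V x) (x : Ambient n))
    simp only [sum_apply, smul_apply, hT.left x, zero_apply] at this
    exact this
  · intro x
    rw [hdivX]
    exact div_nonneg (Finset.sum_nonneg fun i _ => Finset.sum_nonneg fun j _ => sq_nonneg _)
      two_pos.le

/-! ### The rotationally symmetric constraint equations have no solution -/

/-- The rotationally symmetric constraint equations on the sphere, as ordinary differential
equations in the geodesic distance `r` to the pole, with `h = φ`, `f = (LW)(∂ᵣ, ∂ᵣ)` and `t = τ`.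
The Misner–Sharp mass
`M = sin^(n-2) r (h² - J²) + sin^n r h^N (t / n - f / ((n - 1) h^N))²` with
`J = h cos r + 2 / (n - 2) h' sin r` is constant, hence zero, since it vanishes at the pole. As `J`
is proportional to the derivative of the area radius, it has a zero, where `M` is positive. -/
lemma no_radial_ode {n : ℕ} (hn : 3 ≤ n) {h h₁ h₂ f f₁ t t₁ : ℝ → ℝ} (hpos : ∀ r, 0 < h r)
    (hh : ∀ r, HasDerivAt h (h₁ r) r) (hh₁ : ∀ r, HasDerivAt h₁ (h₂ r) r)
    (hf : ∀ r, HasDerivAt f (f₁ r) r) (ht : ∀ r, HasDerivAt t (t₁ r) r)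
    (hlich : ∀ r ∈ Set.Ioo 0 Real.pi,
      -(4 * ((n : ℝ) - 1) / ((n : ℝ) - 2)) *
          (h₂ r + (n - 1) * (Real.cos r / Real.sin r * h₁ r)) + (n : ℝ) * (n - 1) * h r
        = -(((n : ℝ) - 1) / n) * t r ^ 2 * h r ^ (critExp n - 1)
          + (f r ^ 2 + (n - 1) * (f r / (n - 1)) ^ 2) / h r ^ (critExp n + 1))
    (hvec : ∀ r ∈ Set.Ioo 0 Real.pi,
      f₁ r + n * (Real.cos r / Real.sin r * f r)
        = ((n : ℝ) - 1) / n * h r ^ critExp n * t₁ r) : False := by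
  obtain ⟨m, rfl⟩ : ∃ m, n = m + 3 := ⟨n - 3, by omega⟩
  set N := critExp (m + 3) with hN
  set q : ℝ := 2 / ((m : ℝ) + 1) with hq
  have hm : (0 : ℝ) ≤ m := Nat.cast_nonneg m
  have hm1 : (m : ℝ) + 1 ≠ 0 := by positivity
  have hm2 : (m : ℝ) + 2 ≠ 0 := by positivity
  have hm3 : (m : ℝ) + 3 ≠ 0 := by positivity
  have hNq : N = 2 * ((m : ℝ) + 3) / ((m : ℝ) + 1) := by
    rw [hN, critExp]; push_cast; congr 1; ring
  set J : ℝ → ℝ := fun r => Real.cos r * h r + q * (Real.sin r * h₁ r) with hJ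
  set H : ℝ → ℝ := fun r => h r ^ N with hH
  have hHpos : ∀ r, 0 < H r := fun r => Real.rpow_pos_of_pos (hpos r) N
  have hHd : ∀ r, HasDerivAt H (N * (H r / h r) * h₁ r) r := by
    intro r
    refine ((hh r).rpow_const (p := N) (Or.inl (hpos r).ne')).congr_deriv ?_
    rw [Real.rpow_sub_one (hpos r).ne']
    ring
  set κ : ℝ → ℝ := fun r => t r / (m + 3) - f r / ((m + 2) * H r) with hκ
  have hJd : ∀ r, HasDerivAt J (-Real.sin r * h r + Real.cos r * h₁ r
      + q * (Real.cos r * h₁ r + Real.sin r * h₂ r)) r := fun r =>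
    ((Real.hasDerivAt_cos r).mul (hh r)).add
      (((Real.hasDerivAt_sin r).mul (hh₁ r)).const_mul q)
  have hκd : ∀ r, HasDerivAt κ (t₁ r / (m + 3) - (f₁ r * ((m + 2) * H r)
      - f r * ((m + 2) * (N * (H r / h r) * h₁ r))) / ((m + 2) * H r) ^ 2) r := fun r =>
    ((ht r).div_const _).sub ((hf r).div ((hHd r).const_mul _)
      (mul_ne_zero hm2 (hHpos r).ne'))
  set M : ℝ → ℝ := fun r => Real.sin r ^ (m + 1) * (h r ^ 2 - J r ^ 2)
    + Real.sin r ^ (m + 3) * (H r * κ r ^ 2) with hM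
  have hMd : ∀ r, ∃ M' : ℝ, HasDerivAt M M' r ∧ (r ∈ Set.Ioo 0 Real.pi → M' = 0) := by
    intro r
    have hA := (((Real.hasDerivAt_sin r).pow (m + 1)).mul
      (((hh r).pow 2).sub ((hJd r).pow 2))).add
      (((Real.hasDerivAt_sin r).pow (m + 3)).mul ((hHd r).mul ((hκd r).pow 2)))
    refine ⟨_, hA, fun hr => ?_⟩
    have hs : Real.sin r ≠ 0 := (Real.sin_pos_of_mem_Ioo hr).ne'
    have hh0 : h r ≠ 0 := (hpos r).ne'
    have hH0 : H r ≠ 0 := (hHpos r).ne'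
    have hcs : Real.sin r ^ 2 + Real.cos r ^ 2 = 1 := Real.sin_sq_add_cos_sq r
    have e1 := hlich r hr
    have e2 := hvec r hr
    rw [Real.rpow_sub_one hh0, Real.rpow_add_one hh0] at e1
    change _ = _ * (H r / h r) + _ / (H r * h r) at e1
    change _ = _ * H r * _ at e2
    push_cast at e1 e2
    have e2' : f₁ r = (m + 2) / (m + 3) * H r * t₁ r
        - (m + 3) * (Real.cos r / Real.sin r * f r) := by
      linear_combination e2
    have e1' : h₂ r = -((m + 2) * (Real.cos r / Real.sin r * h₁ r))
        + (m + 1) / (4 * (m + 2)) * ((m + 3) * (m + 2) * h r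
          + (m + 2) / (m + 3) * t r ^ 2 * (H r / h r)
          - (f r ^ 2 + (m + 2) * (f r / (m + 2)) ^ 2) / (H r * h r)) := by
      have a1 : (m : ℝ) + 3 - 1 = m + 2 := by ring
      have a2 : (m : ℝ) + 3 - 2 = m + 1 := by ring
      rw [a1, a2] at e1
      have a3 : (m + 1 : ℝ) / (4 * (m + 2)) * (4 * (m + 2) / (m + 1)) = 1 := by field_simp
      linear_combination (-(m + 1 : ℝ) / (4 * (m + 2))) * e1
        - (h₂ r + (m + 2) * (Real.cos r / Real.sin r * h₁ r)) * a3
    -- The Hamiltonian constraint determines `J'` and the momentum constraint determines `κ'`.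
    have eJ : J r = Real.cos r * h r + q * (Real.sin r * h₁ r) := rfl
    have eh₁ : h₁ r = (m + 1) / 2 * (J r - Real.cos r * h r) / Real.sin r := by
      rw [eJ, hq]; field_simp; ring
    have eH₁ : N * (H r / h r) * h₁ r
        = H r * ((m + 3) * (J r - Real.cos r * h r) / (Real.sin r * h r)) := by
      rw [eh₁, hNq]; field_simp
    have eκ : κ r = t r / (m + 3) - f r / ((m + 2) * H r) := rfl
    have eκ₁ : t₁ r / (m + 3) - (f₁ r * ((m + 2) * H r)
        - f r * ((m + 2) * (N * (H r / h r) * h₁ r))) / ((m + 2) * H r) ^ 2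
        = f r / ((m + 2) * H r) * ((m + 3) * J r / (Real.sin r * h r)) := by
      rw [eH₁, e2']; field_simp; ring
    have eJ₁ : -Real.sin r * h r + Real.cos r * h₁ r
        + q * (Real.cos r * h₁ r + Real.sin r * h₂ r)
        = -Real.sin r * h r - Real.cos r * h₁ r + (m + 3) / 2 * Real.sin r * h r
          + Real.sin r / (2 * h r) * (m + 3) * H r
            * ((t r / (m + 3)) ^ 2 - (f r / ((m + 2) * H r)) ^ 2) := by
      rw [e1', hq]; field_simp; ring
    simp only [Pi.pow_apply, Pi.mul_apply, Pi.sub_apply]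
    rw [eJ₁, eκ₁, eH₁, eκ, eh₁]
    generalize J r = y at *
    generalize H r = w at *
    push_cast
    simp only [pow_succ, pow_zero, one_mul]
    -- After clearing denominators, an identity modulo `cos² r = 1 - sin² r` remains.
    have hc2 : Real.cos r ^ 2 = 1 - Real.sin r ^ 2 := by linarith
    field_simp
    ring_nf
    simp only [hc2]
    ring
  have hM0 : M 0 = 0 := by simp [hM]
  have hMcont : Continuous M := continuous_iff_continuousAt.2 fun r =>
    (hMd r).choose_spec.1.continuousAt
  have hMzero : ∀ r ∈ Set.Ioo 0 Real.pi, M r = 0 := by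
    intro r hr
    obtain ⟨c, hc, hc'⟩ := exists_hasDerivAt_eq_slope M (fun r => (hMd r).choose) hr.1
      hMcont.continuousOn fun x _ => (hMd x).choose_spec.1
    have h0 := (hMd c).choose_spec.2 ⟨hc.1, hc.2.trans hr.2⟩
    rw [h0, hM0, sub_zero, sub_zero, eq_comm, div_eq_zero_iff] at hc'
    exact hc'.resolve_right hr.1.ne'
  have hJcont : Continuous J := continuous_iff_continuousAt.2 fun r => (hJd r).continuousAt
  have hJ0 : 0 < J 0 := by simpa [hJ] using hpos 0
  have hJpi : J Real.pi < 0 := by simpa [hJ] using hpos Real.pi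
  obtain ⟨r, hr, hJr⟩ := intermediate_value_Icc' Real.pi_pos.le hJcont.continuousOn
    ⟨hJpi.le, hJ0.le⟩
  have hr0 : r ≠ 0 := by rintro rfl; exact hJ0.ne' hJr
  have hrpi : r ≠ Real.pi := by rintro rfl; exact hJpi.ne hJr
  have hr' : r ∈ Set.Ioo 0 Real.pi :=
    ⟨lt_of_le_of_ne hr.1 (Ne.symm hr0), lt_of_le_of_ne hr.2 hrpi⟩
  have hMr := hMzero r hr'
  have hs := Real.sin_pos_of_mem_Ioo hr'
  have h1 : 0 < Real.sin r ^ (m + 1) * (h r ^ 2 - J r ^ 2) := by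
    rw [hJr]
    have : 0 < h r ^ 2 - 0 ^ 2 := by simpa using pow_pos (hpos r) 2
    positivity
  have h2 : 0 ≤ Real.sin r ^ (m + 3) * (H r * κ r ^ 2) := by
    have := hHpos r
    positivity
  simp only [hM] at hMr
  linarith

/-! ### Radial functions and invariant tensors along a meridian -/

/-- The great circle through `p` in the direction of `e ⊥ p`, parametrized by arc length. -/
noncomputable def meridian (p e : Sph n) (hpe : ⟪(p : Ambient n), (e : Ambient n)⟫ = 0) (r : ℝ) :
    Sph n :=
  ⟨Real.cos r • (p : Ambient n) + Real.sin r • (e : Ambient n), by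
    have h : ‖Real.cos r • (p : Ambient n) + Real.sin r • (e : Ambient n)‖ ^ 2 = 1 := by
      rw [← real_inner_self_eq_norm_sq]
      simp only [inner_add_left, inner_add_right, inner_smul_left, inner_smul_right, conj_trivial,
        inner_coe_self, hpe, real_inner_comm (p : Ambient n) (e : Ambient n)]
      nlinarith [Real.sin_sq_add_cos_sq r]
    rw [mem_sphere_zero_iff_norm]
    nlinarith [norm_nonneg (Real.cos r • (p : Ambient n) + Real.sin r • (e : Ambient n))]⟩

/-- The velocity of the meridian, as a point of the sphere. -/
noncomputable def meridianVelocity (p e : Sph n)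
    (hpe : ⟪(p : Ambient n), (e : Ambient n)⟫ = 0) (r : ℝ) : Sph n :=
  meridian p e hpe (r + Real.pi / 2)

section

variable {p e e' : Sph n} (hpe : ⟪(p : Ambient n), (e : Ambient n)⟫ = 0)

lemma coe_meridian (r : ℝ) : (meridian p e hpe r : Ambient n)
    = Real.cos r • (p : Ambient n) + Real.sin r • (e : Ambient n) := rfl

lemma coe_meridianVelocity (r : ℝ) : (meridianVelocity p e hpe r : Ambient n)
    = -Real.sin r • (p : Ambient n) + Real.cos r • (e : Ambient n) := by
  rw [meridianVelocity, coe_meridian, Real.cos_add_pi_div_two, Real.sin_add_pi_div_two]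

lemma hasDerivAt_meridian (r : ℝ) : HasDerivAt (fun r => (meridian p e hpe r : Ambient n))
    (meridianVelocity p e hpe r : Ambient n) r := by
  rw [coe_meridianVelocity]
  exact ((Real.hasDerivAt_cos r).smul_const _).add ((Real.hasDerivAt_sin r).smul_const _)

lemma hasDerivAt_meridianVelocity (r : ℝ) :
    HasDerivAt (fun r => (meridianVelocity p e hpe r : Ambient n))
      (-(meridian p e hpe r : Ambient n)) r := by
  have h : -(meridian p e hpe r : Ambient n) = -Real.cos r • (p : Ambient n)
      + -Real.sin r • (e : Ambient n) := by
    rw [coe_meridian]; module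
  rw [h]
  simp only [coe_meridianVelocity]
  exact ((Real.hasDerivAt_sin r).neg.smul_const _).add ((Real.hasDerivAt_cos r).smul_const _)

lemma inner_meridian_velocity (r : ℝ) :
    ⟪(meridian p e hpe r : Ambient n), (meridianVelocity p e hpe r : Ambient n)⟫ = 0 := by
  rw [coe_meridianVelocity, coe_meridian]
  simp only [inner_add_left, inner_add_right, inner_smul_left, inner_smul_right, conj_trivial,
    inner_coe_self, hpe, real_inner_comm (p : Ambient n) (e : Ambient n)]
  ring

lemma inner_left_meridian (r : ℝ) :
    ⟪(p : Ambient n), (meridian p e hpe r : Ambient n)⟫ = Real.cos r := by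
  simp [coe_meridian, inner_add_right, inner_smul_right, hpe]

lemma endpoint_eq (r : ℝ) : (e : Ambient n) = Real.cos r • (meridianVelocity p e hpe r : Ambient n)
    + Real.sin r • (meridian p e hpe r : Ambient n) := by
  rw [coe_meridianVelocity, coe_meridian]
  have h : (e : Ambient n) = (Real.sin r ^ 2 + Real.cos r ^ 2) • (e : Ambient n) := by
    rw [Real.sin_sq_add_cos_sq, one_smul]
  conv_lhs => rw [h]
  module

lemma pole_eq (r : ℝ) : (p : Ambient n) = -Real.sin r • (meridianVelocity p e hpe r : Ambient n)
    + Real.cos r • (meridian p e hpe r : Ambient n) := by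
  rw [coe_meridianVelocity, coe_meridian]
  have h : (p : Ambient n) = (Real.sin r ^ 2 + Real.cos r ^ 2) • (p : Ambient n) := by
    rw [Real.sin_sq_add_cos_sq, one_smul]
  conv_lhs => rw [h]
  module

/-- A vector orthogonal to a point of a meridian and to its velocity is orthogonal to the pole and
to the initial direction. -/
lemma inner_eq_zero_of_meridian {r : ℝ} {v : Ambient n}
    (h1 : ⟪(meridian p e hpe r : Ambient n), v⟫ = 0)
    (h2 : ⟪(meridianVelocity p e hpe r : Ambient n), v⟫ = 0) :
    ⟪(p : Ambient n), v⟫ = 0 ∧ ⟪(e : Ambient n), v⟫ = 0 := by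
  constructor
  · rw [pole_eq hpe r, inner_add_left, inner_smul_left, inner_smul_left, h1, h2]; simp
  · rw [endpoint_eq hpe r, inner_add_left, inner_smul_left, inner_smul_left, h1, h2]; simp

end

lemma IsRadial.eq_of_inner_eq {p : Sph n} {f : Sph n → ℝ} (hf : IsRadial p f) {x y : Sph n}
    (h : ⟪(p : Ambient n), (x : Ambient n)⟫ = ⟪(p : Ambient n), (y : Ambient n)⟫) : f x = f y := by
  obtain ⟨g, hg⟩ := hf
  rw [hg, hg, geodesicDist, geodesicDist, InnerProductGeometry.angle, InnerProductGeometry.angle, h,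
    norm_coe, norm_coe, norm_coe]

/-- Two orthogonal unit vectors extend to an orthonormal basis. -/
lemma exists_adapted_basis (hn : 1 ≤ n) {x v : Sph n}
    (hxv : ⟪(x : Ambient n), (v : Ambient n)⟫ = 0) :
    ∃ b : OrthonormalBasis (Option (Option (Fin (n - 1)))) ℝ (Ambient n),
      b none = x ∧ b (some none) = v := by
  let w : Option (Option (Fin (n - 1))) → Ambient n := fun i => i.elim x fun j => j.elim v 0
  have hw : Orthonormal ℝ (Set.domRestrict {none, some none} w) := by
    rw [orthonormal_iff_ite]
    rintro ⟨i, hi⟩ ⟨j, hj⟩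
    simp only [Set.domRestrict_apply, Subtype.mk.injEq]
    have hvx : ⟪(v : Ambient n), (x : Ambient n)⟫ = 0 := by rw [real_inner_comm, hxv]
    rcases hi with rfl | rfl <;> rcases hj with rfl | rfl <;> simp [w, hxv, hvx]
  obtain ⟨b, hb⟩ := hw.exists_orthonormalBasis_extension_of_card_eq (by simp; omega)
  exact ⟨b, hb _ (by simp), hb _ (by simp)⟩

/-- The trace of a bilinear form that takes a constant value on the unit vectors orthogonal to two
given orthogonal unit vectors. -/
lemma sum_frame_adapted (hn : 1 ≤ n) {x v : Sph n}
    (hxv : ⟪(x : Ambient n), (v : Ambient n)⟫ = 0) (B : Ambient n →L[ℝ] Ambient n →L[ℝ] ℝ) (β : ℝ)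
    (hβ : ∀ u : Sph n, ⟪(x : Ambient n), (u : Ambient n)⟫ = 0 →
      ⟪(v : Ambient n), (u : Ambient n)⟫ = 0 → B (u : Ambient n) (u : Ambient n) = β) :
    ∑ i, B (frame i) (frame i)
      = B (x : Ambient n) (x : Ambient n) + (B (v : Ambient n) (v : Ambient n) + (n - 1) * β) := by
  obtain ⟨b, hb0, hb1⟩ := exists_adapted_basis hn hxv
  have hk : ∀ k, B (b (some (some k))) (b (some (some k))) = β := by
    intro k
    refine hβ ⟨b (some (some k)), by simp⟩ ?_ ?_
    · rw [← hb0]; exact b.orthonormal.2 (by simp)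
    · rw [← hb1]; exact b.orthonormal.2 (by simp)
  rw [← sum_bilin_basis b, Fintype.sum_option, Fintype.sum_option, hb0, hb1]
  simp [hk, Nat.cast_sub hn]

/-- The Laplacian of a radial function: `Δφ = φ'' + (n - 1) cot r φ'`. -/
lemma laplacian_radial (hn : 1 ≤ n) {p e : Sph n}
    (hpe : ⟪(p : Ambient n), (e : Ambient n)⟫ = 0)
    {φ : Sph n → ℝ} (hφ : SphDiff 2 φ) (hrad : IsRadial p φ) {r : ℝ} (hr : Real.sin r ≠ 0) :
    laplacian φ (meridian p e hpe r)
      = differential (differential φ) (meridian p e hpe r)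
          (meridianVelocity p e hpe r : Ambient n) (meridianVelocity p e hpe r : Ambient n)
        + (n - 1) * (Real.cos r / Real.sin r
          * differential φ (meridian p e hpe r) (meridianVelocity p e hpe r : Ambient n)) := by
  set x := meridian p e hpe r with hx
  set v := meridianVelocity p e hpe r with hv
  have hd : SphDiff 1 (differential φ) :=
    SphDiff.differential (k := 1) (by simpa [one_add_one_eq_two] using hφ)
  rw [laplacian_eq hφ, sum_frame_adapted hn (inner_meridian_velocity hpe r) _
    (Real.cos r / Real.sin r * differential φ x (v : Ambient n)), differential_self one_ne_zero hd]
  · simp [← hv]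
  intro u hu1 hu2
  obtain ⟨hpu, heu⟩ := inner_eq_zero_of_meridian hpe hu1 hu2
  have hpt : ∀ t, ⟪(p : Ambient n), (meridian e u heu t : Ambient n)⟫ = 0 := by
    intro t
    simp [coe_meridian, inner_add_right, inner_smul_right, hpe, hpu]
  -- The circle of latitude through `x` in the direction of `u`.
  let c : ℝ → Sph n := fun t => meridian p (meridian e u heu t) (hpt t) r
  have hc : ∀ t, HasDerivAt (fun t => (c t : Ambient n))
      (Real.sin r • (meridianVelocity e u heu t : Ambient n)) t := fun t =>
    ((hasDerivAt_meridian heu t).const_smul (Real.sin r)).const_add _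
  have hzero : ∀ t, differential φ (c t) (meridianVelocity e u heu t : Ambient n) = 0 := by
    intro t
    have h1 := hasDerivAt_comp_curve two_ne_zero hφ (hc t)
    have h2 : (fun t => φ (c t)) = fun _ => φ x := by
      funext s
      exact hrad.eq_of_inner_eq (by rw [inner_left_meridian, hx, inner_left_meridian])
    rw [h2] at h1
    have h3 := h1.unique (hasDerivAt_const t (φ x))
    rw [map_smul, smul_eq_mul] at h3
    exact (mul_eq_zero.1 h3).resolve_left hr
  have hc0 : c 0 = x := by ext1; simp [c, hx, coe_meridian]
  have hv0 : (meridianVelocity e u heu 0 : Ambient n) = u := by simp [coe_meridianVelocity]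
  have he0 : (meridian e u heu 0 : Ambient n) = e := by simp [coe_meridian]
  have h4 := (hasDerivAt_comp_curve one_ne_zero hd (hc 0)).clm_apply
    (hasDerivAt_meridianVelocity heu 0)
  simp only [hzero] at h4
  have h5 := h4.unique (hasDerivAt_const 0 (0 : ℝ))
  rw [hc0, hv0, he0] at h5
  have h6 : differential φ x (e : Ambient n) = Real.cos r * differential φ x (v : Ambient n) := by
    conv_lhs => rw [endpoint_eq hpe r]
    rw [map_add, map_smul, map_smul, ← hx, differential_self two_ne_zero hφ]
    simp [← hv]
  simp only [map_smul, smul_apply, map_neg, h6, smul_eq_mul] at h5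
  field_simp
  linarith

/-- A field of bilinear forms that is invariant under the isometries fixing `p`. -/
def IsInvariant (p : Sph n) (B : Sph n → Ambient n →L[ℝ] Ambient n →L[ℝ] ℝ) : Prop :=
  ∀ A : Ambient n ≃ₗᵢ[ℝ] Ambient n, A (p : Ambient n) = p → ∀ x a b,
    B (rotate A x) (A a) (A b) = B x a b

section

variable {p e : Sph n} (hpe : ⟪(p : Ambient n), (e : Ambient n)⟫ = 0)
  {B : Sph n → Ambient n →L[ℝ] Ambient n →L[ℝ] ℝ}

/-- The reflection in the hyperplane orthogonal to a vector. -/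
noncomputable def hyperplaneReflection (u : Ambient n) : Ambient n ≃ₗᵢ[ℝ] Ambient n :=
  (ℝ ∙ u)ᗮ.reflection

lemma hyperplaneReflection_self (u : Ambient n) : hyperplaneReflection u u = -u :=
  Submodule.reflection_orthogonalComplement_singleton_eq_neg u

lemma hyperplaneReflection_of_inner_eq_zero {u v : Ambient n} (h : ⟪u, v⟫ = 0) :
    hyperplaneReflection u v = v :=
  Submodule.reflection_mem_subspace_eq_self (Submodule.mem_orthogonal_singleton_iff_inner_right.2 h)

/-- An invariant form pairs a direction tangent to the sphere of latitude to zero with everything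
orthogonal to it, by invariance under the reflection that changes its sign. -/
lemma IsInvariant.apply_eq_zero (hB : IsInvariant p B) (r : ℝ) {u w : Ambient n}
    (hpu : ⟪(p : Ambient n), u⟫ = 0) (heu : ⟪(e : Ambient n), u⟫ = 0) (hw : ⟪u, w⟫ = 0) :
    B (meridian p e hpe r) u w = 0 := by
  have hp : hyperplaneReflection u (p : Ambient n) = p :=
    hyperplaneReflection_of_inner_eq_zero (by rw [real_inner_comm, hpu])
  have he : hyperplaneReflection u (e : Ambient n) = e :=
    hyperplaneReflection_of_inner_eq_zero (by rw [real_inner_comm, heu])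
  have h := hB (hyperplaneReflection u) hp (meridian p e hpe r) u w
  have hx : rotate (hyperplaneReflection u) (meridian p e hpe r) = meridian p e hpe r := by
    ext1
    simp [coe_meridian, hp, he]
  rw [hx, hyperplaneReflection_self, hyperplaneReflection_of_inner_eq_zero hw] at h
  simp only [map_neg, neg_apply] at h
  linarith

/-- An invariant form takes the same value on all unit vectors tangent to the sphere of latitude. -/
lemma IsInvariant.apply_self_eq (hB : IsInvariant p B) (r : ℝ) {u w : Sph n}
    (hpu : ⟪(p : Ambient n), (u : Ambient n)⟫ = 0) (heu : ⟪(e : Ambient n), (u : Ambient n)⟫ = 0)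
    (hpw : ⟪(p : Ambient n), (w : Ambient n)⟫ = 0) (hew : ⟪(e : Ambient n), (w : Ambient n)⟫ = 0) :
    B (meridian p e hpe r) (u : Ambient n) (u : Ambient n)
      = B (meridian p e hpe r) (w : Ambient n) (w : Ambient n) := by
  set A := hyperplaneReflection ((u : Ambient n) - (w : Ambient n)) with hA
  have hp : A (p : Ambient n) = p :=
    hyperplaneReflection_of_inner_eq_zero (by rw [real_inner_comm, inner_sub_right, hpu, hpw,
      sub_zero])
  have he : A (e : Ambient n) = e :=
    hyperplaneReflection_of_inner_eq_zero (by rw [real_inner_comm, inner_sub_right, heu, hew,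
      sub_zero])
  have h := hB A hp (meridian p e hpe r) u u
  have hx : rotate A (meridian p e hpe r) = meridian p e hpe r := by
    ext1
    simp [coe_meridian, hp, he]
  have hu : A (u : Ambient n) = w := Submodule.reflection_sub (by simp)
  rw [hx, hu] at h
  exact h.symm

end

/-- The trace-free invariant tensors: their value on the directions tangent to the spheres of
latitude is determined by the radial component. -/
lemma IsInvariant.apply_latitude (hn : 2 ≤ n) {p e : Sph n}
    (hpe : ⟪(p : Ambient n), (e : Ambient n)⟫ = 0)
    {B : Sph n → Ambient n →L[ℝ] Ambient n →L[ℝ] ℝ} (hB : IsInvariant p B) (hT : IsTangential B)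
    (htr : ∀ x, ∑ i, B x (frame i) (frame i) = 0) (r : ℝ) {u : Sph n}
    (hpu : ⟪(p : Ambient n), (u : Ambient n)⟫ = 0)
    (heu : ⟪(e : Ambient n), (u : Ambient n)⟫ = 0) :
    B (meridian p e hpe r) (u : Ambient n) (u : Ambient n)
      = -(B (meridian p e hpe r) (meridianVelocity p e hpe r : Ambient n)
        (meridianVelocity p e hpe r : Ambient n) / (n - 1)) := by
  have h := sum_frame_adapted (by omega) (inner_meridian_velocity hpe r) (B (meridian p e hpe r))
    (B (meridian p e hpe r) (u : Ambient n) (u : Ambient n)) (fun w hw1 hw2 => by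
      obtain ⟨hpw, hew⟩ := inner_eq_zero_of_meridian hpe hw1 hw2
      exact hB.apply_self_eq hpe r hpw hew hpu heu)
  rw [htr, hT.right] at h
  have hn1 : (n : ℝ) - 1 ≠ 0 := by
    have : (2 : ℝ) ≤ n := by exact_mod_cast hn
    linarith
  field_simp
  linarith

/-- The squared norm of an invariant trace-free tensor, which is diagonal in an orthonormal basis
adapted to the meridian. -/
lemma IsInvariant.sum_sq (hn : 2 ≤ n) {p e : Sph n}
    (hpe : ⟪(p : Ambient n), (e : Ambient n)⟫ = 0)
    {B : Sph n → Ambient n →L[ℝ] Ambient n →L[ℝ] ℝ} (hB : IsInvariant p B) (hT : IsTangential B)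
    (hsymm : ∀ x a b, B x a b = B x b a)
    (htr : ∀ x, ∑ i, B x (frame i) (frame i) = 0) (r : ℝ) :
    ∑ i, ∑ j, B (meridian p e hpe r) (frame i) (frame j) ^ 2
      = B (meridian p e hpe r) (meridianVelocity p e hpe r : Ambient n)
          (meridianVelocity p e hpe r : Ambient n) ^ 2
        + (n - 1) * (B (meridian p e hpe r) (meridianVelocity p e hpe r : Ambient n)
          (meridianVelocity p e hpe r : Ambient n) / (n - 1)) ^ 2 := by
  set x := meridian p e hpe r with hx
  set v := meridianVelocity p e hpe r with hv
  obtain ⟨b, hb0, hb1⟩ := exists_adapted_basis (by omega) (inner_meridian_velocity hpe r)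
  rw [← hx] at hb0
  rw [← hv] at hb1
  have horth : ∀ k, ⟪(p : Ambient n), b (some (some k))⟫ = 0 ∧
      ⟪(e : Ambient n), b (some (some k))⟫ = 0 := by
    intro k
    refine inner_eq_zero_of_meridian hpe (r := r) ?_ ?_
    · rw [← hx, ← hb0]; exact b.orthonormal.2 (by simp)
    · rw [← hv, ← hb1]; exact b.orthonormal.2 (by simp)
  have hoff : ∀ k l, l ≠ k → B x (b k) (b l) = 0 := by
    intro k l hkl
    rcases k with _ | _ | k
    · rw [hb0, hT.left]; rfl
    · rcases l with _ | _ | l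
      · rw [hb0, hT.right]
      · exact absurd rfl hkl
      · rw [hsymm]
        exact hB.apply_eq_zero hpe r (horth l).1 (horth l).2 (b.orthonormal.2 hkl)
    · exact hB.apply_eq_zero hpe r (horth k).1 (horth k).2 (b.orthonormal.2 hkl.symm)
  have hdiag : ∀ k, ∑ l, B x (b k) (b l) ^ 2 = B x (b k) (b k) ^ 2 := fun k =>
    Fintype.sum_eq_single k fun l hl => by rw [hoff k l hl]; simp
  have hlat : ∀ k, B x (b (some (some k))) (b (some (some k)))
      = -(B x (v : Ambient n) (v : Ambient n) / (n - 1)) := fun k =>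
    hB.apply_latitude hn hpe hT htr r (u := ⟨b (some (some k)), by simp⟩) (horth k).1 (horth k).2
  rw [← sum_sq_basis b]
  simp only [hdiag]
  rw [Fintype.sum_option, Fintype.sum_option, hb0, hb1, hT.right]
  simp [hlat, Nat.cast_sub (show 1 ≤ n by omega)]

/-- The radial component of the divergence of an invariant trace-free tensor with radial component
`f` is `f' + n cot r f`. -/
lemma IsInvariant.div (hn : 2 ≤ n) {p e : Sph n}
    (hpe : ⟪(p : Ambient n), (e : Ambient n)⟫ = 0)
    {B : Sph n → Ambient n →L[ℝ] Ambient n →L[ℝ] ℝ} (hB : IsInvariant p B) (hT : IsTangential B)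
    (htr : ∀ x, ∑ i, B x (frame i) (frame i) = 0) (hs : SphDiff 1 B) {r : ℝ}
    (hr : Real.sin r ≠ 0) :
    ∑ i, differential B (meridian p e hpe r) (frame i) (frame i)
        (meridianVelocity p e hpe r : Ambient n)
      = differential B (meridian p e hpe r) (meridianVelocity p e hpe r : Ambient n)
          (meridianVelocity p e hpe r : Ambient n) (meridianVelocity p e hpe r : Ambient n)
        + n * (Real.cos r / Real.sin r * B (meridian p e hpe r)
          (meridianVelocity p e hpe r : Ambient n) (meridianVelocity p e hpe r : Ambient n)) := by
  set x := meridian p e hpe r with hx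
  set v := meridianVelocity p e hpe r with hv
  set f := B x (v : Ambient n) (v : Ambient n) with hf
  have hn1 : (n : ℝ) - 1 ≠ 0 := by
    have : (2 : ℝ) ≤ n := by exact_mod_cast hn
    linarith
  have h := sum_frame_adapted (by omega) (inner_meridian_velocity hpe r)
    (((flipCLM n ℝ).comp (differential B x)).flip (v : Ambient n))
    (n / (n - 1) * (Real.cos r / Real.sin r * f)) ?_
  · rw [← hx, ← hv] at h
    have hfl : ∀ a b : Ambient n, ((flipCLM n ℝ).comp (differential B x)).flip (v : Ambient n) a b
        = differential B x a b (v : Ambient n) := fun _ _ => rfl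
    simp only [hfl, differential_self one_ne_zero hs] at h
    rw [h]
    simp only [zero_apply]
    field_simp
    ring
  intro u hu1 hu2
  change differential B x (u : Ambient n) (u : Ambient n) (v : Ambient n) = _
  obtain ⟨hpu, heu⟩ := inner_eq_zero_of_meridian hpe hu1 hu2
  have hpt : ∀ t, ⟪(p : Ambient n), (meridian e u heu t : Ambient n)⟫ = 0 := by
    intro t
    simp [coe_meridian, inner_add_right, inner_smul_right, hpe, hpu]
  have hpt' : ∀ t, ⟪(p : Ambient n), (meridianVelocity e u heu t : Ambient n)⟫ = 0 := fun t => hpt _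
  -- Along the circle of latitude through `x` in the direction of `u`, the component of the tensor
  -- in the direction of the circle and the radial direction vanishes.
  let c : ℝ → Sph n := fun t => meridian p (meridian e u heu t) (hpt t) r
  let w : ℝ → Ambient n := fun t =>
    -Real.sin r • (p : Ambient n) + Real.cos r • (meridian e u heu t : Ambient n)
  have hc : HasDerivAt (fun t => (c t : Ambient n))
      (Real.sin r • (meridianVelocity e u heu 0 : Ambient n)) 0 :=
    ((hasDerivAt_meridian heu 0).const_smul (Real.sin r)).const_add _
  have hw : HasDerivAt w (Real.cos r • (meridianVelocity e u heu 0 : Ambient n)) 0 :=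
    ((hasDerivAt_meridian heu 0).const_smul (Real.cos r)).const_add _
  have hzero : ∀ t, B (c t) (meridianVelocity e u heu t : Ambient n) (w t) = 0 := by
    intro t
    refine hB.apply_eq_zero (hpt t) r (hpt' t) (inner_meridian_velocity heu t) ?_
    have h1 := inner_meridian_velocity heu t
    have h2 := hpt' t
    rw [real_inner_comm] at h1 h2
    simp [w, inner_add_right, inner_smul_right, h1, h2]
  have hc0 : c 0 = x := by ext1; simp [c, hx, coe_meridian]
  have hv0 : (meridianVelocity e u heu 0 : Ambient n) = u := by simp [coe_meridianVelocity]
  have he0 : (meridian e u heu 0 : Ambient n) = e := by simp [coe_meridian]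
  have hw0 : w 0 = v := by simp [w, he0, hv, coe_meridianVelocity]
  have h4 := ((hasDerivAt_comp_curve one_ne_zero hs hc).clm_apply
    (hasDerivAt_meridianVelocity heu 0)).clm_apply hw
  simp only [hzero] at h4
  have h5 := h4.unique (hasDerivAt_const 0 (0 : ℝ))
  rw [hc0, hv0, he0, hw0] at h5
  have h6 : B x (e : Ambient n) (v : Ambient n) = Real.cos r * f := by
    conv_lhs => rw [endpoint_eq hpe r]
    rw [map_add, map_smul, map_smul, ← hx, hT.left]
    simp [← hv, hf]
  have h7 := hB.apply_latitude hn hpe hT htr r hpu heu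
  rw [← hx, ← hv, ← hf] at h7
  simp only [map_smul, smul_apply, add_apply, map_neg, neg_apply, h6, h7, smul_eq_mul] at h5
  field_simp at h5 ⊢
  linarith

/-! ### Solutions of the constraint equations -/

lemma exists_orthogonal (hn : 1 ≤ n) (p : Sph n) :
    ∃ e : Sph n, ⟪(p : Ambient n), (e : Ambient n)⟫ = 0 := by
  have : Fact (Module.finrank ℝ (Ambient n) = n + 1) := ⟨by simp⟩
  have hfin : Module.finrank ℝ (ℝ ∙ (p : Ambient n))ᗮ = n :=
    Submodule.finrank_orthogonal_span_singleton (coe_ne_zero p)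
  have : Nontrivial (ℝ ∙ (p : Ambient n))ᗮ :=
    Module.nontrivial_of_finrank_pos (R := ℝ) (by rw [hfin]; omega)
  obtain ⟨v, hv⟩ := exists_ne (0 : (ℝ ∙ (p : Ambient n))ᗮ)
  have hv' : (v : Ambient n) ≠ 0 := by simpa using hv
  refine ⟨unit v hv', ?_⟩
  rw [unit, inner_smul_right, Submodule.mem_orthogonal_singleton_iff_inner_right.1 v.2, mul_zero]

/-- For radial `φ` and `τ`, the tensor `LW` is invariant under the isometries `A` fixing the pole:
`W - A^* W` lies in the kernel of `div L`, hence in the kernel of `L`. -/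
lemma IsConformalSolution.isInvariant (hn : n ≠ 0) {k : ℕ∞} (hk : 2 ≤ k) {p : Sph n}
    {τ φ : Sph n → ℝ} {W : Sph n → Ambient n →L[ℝ] ℝ} (h : IsConformalSolution k τ φ W)
    (hτ : IsRadial p τ) (hφ : IsRadial p φ) : IsInvariant p (killingForm W) := by
  intro A hA x a b
  have h' := h.rotate hn hk (hτ.comp_rotate hA)
  rw [hφ.comp_rotate hA] at h'
  have hW := SphDiff.of_contMDiff h.contMDiff_form
  have hAW := hW.pullForm A
  have hdiv := ((isConformalSolution_iff hn).1 h).2.2.2.2.2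
  have hdiv' := ((isConformalSolution_iff hn).1 h').2.2.2.2.2
  have hsub : killingForm (fun x => W x - pullForm A W x)
      = fun x => killingForm W x - killingForm (pullForm A W) x :=
    funext fun x => killingForm_sub two_ne_zero hW hAW x
  have h0 := killingForm_eq_zero hn (V := fun x => W x - pullForm A W x)
    (fun x => by rw [sub_apply, h.isOneForm x, h'.isOneForm x, sub_zero]) (hW.sub hAW)
    (fun x b hb => by
      simp only [hsub, differential_sub one_ne_zero hW.killingForm hAW.killingForm, sub_apply,
        Finset.sum_sub_distrib]
      rw [hdiv x b hb, hdiv' x b hb, sub_self]) x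
  rw [hsub] at h0
  have h1 : killingForm W x = killingForm (pullForm A W) x := sub_eq_zero.1 h0
  rw [← killingForm_pullForm two_ne_zero hW A, h1]

/-- There is no radial solution: along a meridian it would solve the rotationally symmetric
constraint equations. -/
lemma not_isRadial_of_mem_solutionSet (hn : 3 ≤ n) {k : ℕ∞} (hk : 2 ≤ k) {p : Sph n}
    {τ φ : Sph n → ℝ} (hτ : ContMDiff (𝓡 n) 𝓘(ℝ, ℝ) 1 τ) (hrad : IsRadial p τ)
    (hφ : φ ∈ solutionSet k τ) : ¬ IsRadial p φ := by
  intro hφrad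
  obtain ⟨W, h⟩ := hφ
  obtain ⟨e, hpe⟩ := exists_orthogonal (by omega) p
  have hinv := h.isInvariant (by omega) hk hrad hφrad
  have hW := SphDiff.of_contMDiff h.contMDiff_form
  have hB := hW.killingForm
  have hT := killingForm_isTangential two_ne_zero h.isOneForm hW
  have htr := killingForm_trace (by omega) h.isOneForm
  have hsymm := killingForm_symm W
  have hφ2 : SphDiff 2 φ :=
    (SphDiff.of_contMDiff h.contMDiff_factor).of_le (WithTop.coe_le_coe.2 hk)
  have hd : SphDiff 1 (differential φ) :=
    SphDiff.differential (k := 1) (by simpa [one_add_one_eq_two] using hφ2)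
  have hτ1 := SphDiff.of_contMDiff hτ
  obtain ⟨-, -, -, -, hlich, hvec⟩ := (isConformalSolution_iff (by omega)).1 h
  set γ := meridian p e hpe with hγ
  set ν := meridianVelocity p e hpe with hν
  have hγd : ∀ r, HasDerivAt (fun r => (γ r : Ambient n)) (ν r : Ambient n) r :=
    hasDerivAt_meridian hpe
  have hνd : ∀ r, HasDerivAt (fun r => (ν r : Ambient n)) (-(γ r : Ambient n)) r :=
    hasDerivAt_meridianVelocity hpe
  refine no_radial_ode hn (h := fun r => φ (γ r))
    (h₁ := fun r => differential φ (γ r) (ν r : Ambient n))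
    (h₂ := fun r => differential (differential φ) (γ r) (ν r : Ambient n) (ν r : Ambient n))
    (f := fun r => killingForm W (γ r) (ν r : Ambient n) (ν r : Ambient n))
    (f₁ := fun r => differential (killingForm W) (γ r) (ν r : Ambient n) (ν r : Ambient n)
      (ν r : Ambient n))
    (t := fun r => τ (γ r)) (t₁ := fun r => differential τ (γ r) (ν r : Ambient n))
    (fun r => h.pos _) (fun r => hasDerivAt_comp_curve two_ne_zero hφ2 (hγd r)) ?_ ?_
    (fun r => hasDerivAt_comp_curve one_ne_zero hτ1 (hγd r)) ?_ ?_
  · intro r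
    refine ((hasDerivAt_comp_curve one_ne_zero hd (hγd r)).clm_apply (hνd r)).congr_deriv ?_
    rw [map_neg, differential_self two_ne_zero hφ2, neg_zero, add_zero]
  · intro r
    refine (((hasDerivAt_comp_curve one_ne_zero hB (hγd r)).clm_apply (hνd r)).clm_apply
      (hνd r)).congr_deriv ?_
    rw [map_neg, map_neg, hT.left, hT.right]
    simp
  · intro r hr
    have hs := (Real.sin_pos_of_mem_Ioo hr).ne'
    have h1 := hlich (γ r)
    rw [hγ, laplacian_radial (by omega) hpe hφ2 hφrad hs,
      hinv.sum_sq (by omega) hpe hT hsymm htr r] at h1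
    exact h1
  · intro r hr
    have hs := (Real.sin_pos_of_mem_Ioo hr).ne'
    have h1 := hvec (γ r) (ν r) (inner_meridian_velocity hpe r)
    rw [hγ, hν, hinv.div (by omega) hpe hT htr hB hs] at h1
    exact h1

lemma isRadial_of_forall_inner_eq {p : Sph n} {f : Sph n → ℝ}
    (hf : ∀ x y : Sph n, ⟪(p : Ambient n), (x : Ambient n)⟫ = ⟪(p : Ambient n), (y : Ambient n)⟫ →
      f x = f y) : IsRadial p f := by
  have hfac : Function.FactorsThrough f (geodesicDist p) := by
    intro x y hxy
    refine hf x y ?_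
    have h := congrArg Real.cos hxy
    simpa [geodesicDist, InnerProductGeometry.cos_angle] using h
  exact ⟨Function.extend (geodesicDist p) f 0, fun x => (hfac.extend_apply 0 x).symm⟩

/-- A continuous function attains on a sphere of latitude every value between two values that it
attains there. -/
lemma exists_eq_of_mem_Icc (hn : 2 ≤ n) {p x y : Sph n} {f : Sph n → ℝ} (hf : SphDiff 1 f)
    (hxy : ⟪(p : Ambient n), (x : Ambient n)⟫ = ⟪(p : Ambient n), (y : Ambient n)⟫) {s : ℝ}
    (hs : s ∈ Set.Icc (f x) (f y)) :
    ∃ z : Sph n, ⟪(p : Ambient n), (x : Ambient n)⟫ = ⟪(p : Ambient n), (z : Ambient n)⟫ ∧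
      f z = s := by
  have : Fact (Module.finrank ℝ (Ambient n) = n + 1) := ⟨by simp⟩
  set c := ⟪(p : Ambient n), (x : Ambient n)⟫ with hc
  let K := (ℝ ∙ (p : Ambient n))ᗮ
  have hrank : 1 < Module.rank ℝ K := by
    have hfin : Module.finrank ℝ K = n :=
      Submodule.finrank_orthogonal_span_singleton (coe_ne_zero p)
    rw [← Module.finrank_eq_rank, hfin]
    exact_mod_cast (by omega : 1 < n)
  have hK : ∀ v : K, ⟪(p : Ambient n), (v : Ambient n)⟫ = 0 := fun v =>
    Submodule.mem_orthogonal_singleton_iff_inner_right.1 v.2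
  have hnorm : ∀ v : K, ‖c • (p : Ambient n) + v‖ ^ 2 = c ^ 2 + ‖v‖ ^ 2 := by
    intro v
    rw [norm_add_sq_real, inner_smul_left, hK v, norm_smul, norm_coe]
    simp
  -- The sphere of latitude, as a sphere in the hyperplane orthogonal to the pole.
  let S : Set K := Metric.sphere 0 (Real.sqrt (1 - c ^ 2))
  have hmem : ∀ z : Sph n, ⟪(p : Ambient n), (z : Ambient n)⟫ = c →
      ∃ v ∈ S, c • (p : Ambient n) + (v : Ambient n) = z := by
    intro z hz
    have hv : (z : Ambient n) - c • (p : Ambient n) ∈ K := by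
      rw [Submodule.mem_orthogonal_singleton_iff_inner_right, inner_sub_right, inner_smul_right, hz,
        inner_coe_self]
      ring
    have h1 := hnorm ⟨_, hv⟩
    simp only [add_sub_cancel, norm_coe] at h1
    refine ⟨⟨_, hv⟩, ?_, by simp⟩
    rw [mem_sphere_zero_iff_norm, show 1 - c ^ 2 = ‖(⟨_, hv⟩ : K)‖ ^ 2 by linarith,
      Real.sqrt_sq (norm_nonneg _)]
  have hle : 0 ≤ 1 - c ^ 2 := by
    obtain ⟨v, -, hv⟩ := hmem x rfl
    have := hnorm v
    rw [hv, norm_coe] at this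
    nlinarith [sq_nonneg ‖v‖]
  have hunit : ∀ v ∈ S, ‖c • (p : Ambient n) + (v : Ambient n)‖ = 1 := by
    intro v hv
    have h1 := hnorm v
    rw [mem_sphere_zero_iff_norm.1 hv, Real.sq_sqrt hle] at h1
    have h2 : ‖c • (p : Ambient n) + (v : Ambient n)‖ ^ 2 = 1 := by linarith
    exact (pow_eq_one_iff_of_nonneg (norm_nonneg _) two_ne_zero).1 h2
  have hcont : ContinuousOn (fun v : K => rayExtension f (c • (p : Ambient n) + v)) S := by
    refine hf.continuousOn.comp (by fun_prop) fun v hv => ?_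
    change _ ≠ _
    rw [← norm_ne_zero_iff, hunit v hv]
    exact one_ne_zero
  have hpre := (isPreconnected_sphere hrank (0 : K) (Real.sqrt (1 - c ^ 2))).image _ hcont
  obtain ⟨vx, hvx, hx⟩ := hmem x rfl
  obtain ⟨vy, hvy, hy⟩ := hmem y hxy.symm
  obtain ⟨v, hv, hvs⟩ := hpre.Icc_subset (a := f x) (b := f y)
    ⟨vx, hvx, by simp only [hx, rayExtension_coe]⟩ ⟨vy, hvy, by simp only [hy, rayExtension_coe]⟩ hs
  refine ⟨⟨c • (p : Ambient n) + v, mem_sphere_zero_iff_norm.2 (hunit v hv)⟩, ?_, ?_⟩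
  · rw [inner_add_right, inner_smul_right, hK, inner_coe_self]; ring
  · rw [← hvs]
    exact (rayExtension_coe f ⟨_, mem_sphere_zero_iff_norm.2 (hunit v hv)⟩).symm

/-- A non-radial solution takes infinitely many values on some sphere of latitude; composing it with
isometries fixing the pole, each of them becomes the value of a solution at one given point. -/
lemma solutionSet_infinite (hn : 2 ≤ n) {k : ℕ∞} (hk : 2 ≤ k) {p : Sph n} {τ φ : Sph n → ℝ}
    (hrad : IsRadial p τ) (hφ : φ ∈ solutionSet k τ) (hnr : ¬ IsRadial p φ) :
    (solutionSet k τ).Infinite := by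
  have hφ1 : SphDiff 1 φ := by
    obtain ⟨W, h⟩ := hφ
    exact ((SphDiff.of_contMDiff h.contMDiff_factor).of_le (WithTop.coe_le_coe.2 hk)).of_le
      one_le_two
  obtain ⟨x, y, hxy, hlt⟩ : ∃ x y : Sph n,
      ⟪(p : Ambient n), (x : Ambient n)⟫ = ⟪(p : Ambient n), (y : Ambient n)⟫ ∧ φ x < φ y := by
    by_contra! hcon
    exact hnr (isRadial_of_forall_inner_eq fun x y hxy =>
      le_antisymm (hcon y x hxy.symm) (hcon x y hxy))
  refine Set.Infinite.of_image (fun ψ => ψ x) ((Set.Icc_infinite hlt).mono fun s hs => ?_)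
  obtain ⟨z, hz, hzs⟩ := exists_eq_of_mem_Icc hn hφ1 hxy hs
  set A := hyperplaneReflection ((x : Ambient n) - (z : Ambient n)) with hA
  have hp : A (p : Ambient n) = p :=
    hyperplaneReflection_of_inner_eq_zero (by rw [real_inner_comm, inner_sub_right, hz, sub_self])
  have hx : rotate A x = z := by
    ext1
    exact Submodule.reflection_sub (by simp)
  obtain ⟨W, h⟩ := hφ
  refine ⟨φ ∘ rotate A, ⟨_, h.rotate (by omega) hk (hrad.comp_rotate hp)⟩, ?_⟩
  simp only [Function.comp_apply, hx, hzs]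

end RoundSphere

theorem mainTheorem4 (n : ℕ) (hn : 3 ≤ n) (k : ℕ∞) (hk : 2 ≤ k) (p : RoundSphere.Sph n)
    (τ : RoundSphere.Sph n → ℝ) (hτ : ContMDiff (𝓡 n) 𝓘(ℝ, ℝ) 1 τ)
    (hrad : RoundSphere.IsRadial p τ) :
    (¬ ∃ φ ∈ RoundSphere.solutionSet k τ, RoundSphere.IsRadial p φ) ∧
    (∀ φ ∈ RoundSphere.solutionSet k τ,
      ∀ A : RoundSphere.Ambient n ≃ₗᵢ[ℝ] RoundSphere.Ambient n,
        A (p : RoundSphere.Ambient n) = p →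
          φ ∘ RoundSphere.rotate A ∈ RoundSphere.solutionSet k τ) ∧
    ((RoundSphere.solutionSet k τ).Nonempty → (RoundSphere.solutionSet k τ).Infinite) := by
  have hnot : ∀ φ ∈ RoundSphere.solutionSet k τ, ¬ RoundSphere.IsRadial p φ := fun φ hφ =>
    RoundSphere.not_isRadial_of_mem_solutionSet hn hk hτ hrad hφ
  refine ⟨fun ⟨φ, hφ, hr⟩ => hnot φ hφ hr, ?_, ?_⟩
  · rintro φ ⟨W, h⟩ A hA
    exact ⟨_, h.rotate (by omega) hk (hrad.comp_rotate hA)⟩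
  · rintro ⟨φ, hφ⟩
    exact RoundSphere.solutionSet_infinite (by omega) hk hrad hφ (hnot φ hφ)
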